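/- Let $\mathcal F$ be the Heisenberg Fock space, i.e. the Hilbert space completion of the linear span of the exponential vectors $y(\lambda)$, $\lambda\in\mathbb C$, with $\langle y(\lambda),y(\mu)\rangle=e^{\bar\lambda\mu}$. Let $b,b^\dagger$ be the annihilation and creation operators ($b\,y(\lambda)=\lambda y(\lambda)$, $b^\dagger$ the adjoint of $b$, $[b,b^\dagger]=1$), acting on the common invariant dense domain of vectors whose coefficients in the number basis decrease rapidly, and let $\Phi=y(0)$ be the vacuum vector. Let $z\in\mathbb C$ and $\rho,r\in\mathbb R$ with $r\neq0$. (i) If $\mathrm{Re}\,z\neq0$, put $$a=\Big(\tfrac{4\rho\,\mathrm{Im}z-r^2}{4\,\mathrm{Re}z}+i\rho\Big)(b-b^\dagger)^2-\tfrac{i\bar z}{2r}(b+b^\dagger),\quad a^\dagger=\Big(\tfrac{4\rho\,\mathrm{Im}z-r^2}{4\,\mathrm{Re}z}-i\rho\Big)(b-b^\dagger)^2+\tfrac{iz}{2r}(b+b^\dagger),\quad h=ir(b^\dagger-b),$$ $$L=\frac{4\rho\,\mathrm{Im}z-r^2}{2\,\mathrm{Re}z},\qquad M=-\Big(\frac{\mathrm{Im}z}{r}+ir\Big),\qquad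 N=-\Big(\frac{\mathrm{Im}z}{r}-ir\Big).$$ (ii) If $\mathrm{Re}\,z=0$, put $$a=\Big(\rho-\tfrac{i\,\mathrm{Im}z}{16r^2}\Big)(b-b^\dagger)^2+r(b+b^\dagger),\quad a^\dagger=\Big(\rho+\tfrac{i\,\mathrm{Im}z}{16r^2}\Big)(b-b^\dagger)^2+r(b+b^\dagger),\quad h=\tfrac{i\,\mathrm{Im}z}{2r}(b^\dagger-b),$$ $$L=2\rho,\qquad M=2r-i\frac{\mathrm{Im}z}{2r},\qquad N=2r+i\frac{\mathrm{Im}z}{2r}.$$ Then the closure $X$ of $a+a^\dagger+h$ is self-adjoint, $X=\int_{\mathbb R}x\,dE(x)$ for a projection-valued measure $E$ on $\mathbb R$, and for every $s\in\mathbb R$ with $2Ls+1>0$ the moment generating function $\langle\Phi,e^{s(a+a^\dagger+h)}\Phi\rangle:=\int_{\mathbb R}e^{sx}\,d\langle\Phi,E(x)\Phi\rangle$ is finite and $$\langle\Phi,e^{s(a+a^\dagger+h)}\Phi\rangle=(2Ls+1)^{-1/2}\exp\left\{\frac{(M+N)^2(L^2s^4+2Ls^3)+3MNs^2}{6(2Ls+1)}\right\}.$$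 -/

import Mathlib

open MeasureTheory
open scoped InnerProductSpace ComplexConjugate

noncomputable section

namespace CEHeis

/-! ### Spectral measures of unbounded operators -/

section Spectral

variable {H : Type*} [NormedAddCommGroup H] [InnerProductSpace ℂ H] [CompleteSpace H]

variable (H) in
/-- A projection-valued measure on the Borel sets of the real line
(only the values on measurable sets are meaningful). -/
structure ProjectionMeasure where
  proj : Set ℝ → (H →L[ℂ] H)
  isStarProjection : ∀ A, MeasurableSet A → IsStarProjection (proj A)
  univ : proj Set.univ = 1
  inter : ∀ A B, MeasurableSet A → MeasurableSet B → proj (A ∩ B) = proj A * proj B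
  hasSum_iUnion : ∀ A : ℕ → Set ℝ, (∀ n, MeasurableSet (A n)) →
    Pairwise (Function.onFun Disjoint A) →
    ∀ ψ : H, HasSum (fun n => proj (A n) ψ) (proj (⋃ n, A n) ψ)

namespace ProjectionMeasure

theorem proj_empty (E : ProjectionMeasure H) : E.proj ∅ = 0 := by
  ext ψ
  have h := (E.hasSum_iUnion (fun _ => ∅) (fun _ => MeasurableSet.empty)
    (fun _ _ _ => by simp [Function.onFun]) ψ).summable
  have h2 := h.tendsto_atTop_zero
  simpa using tendsto_nhds_unique tendsto_const_nhds h2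

theorem inner_proj (E : ProjectionMeasure H) {A : Set ℝ} (hA : MeasurableSet A) (ψ : H) :
    0 ≤ (⟪ψ, E.proj A ψ⟫_ℂ).re := by
  have h := E.isStarProjection A hA
  have h1 : E.proj A ψ = E.proj A (E.proj A ψ) := by
    have := congrArg (fun T : H →L[ℂ] H => T ψ) h.isIdempotentElem.eq
    simpa using this.symm
  have h2 : ContinuousLinearMap.adjoint (E.proj A) = E.proj A := h.isSelfAdjoint.star_eq
  rw [h1]
  nth_rewrite 1 [← h2]
  rw [ContinuousLinearMap.adjoint_inner_right]
  exact inner_self_nonneg (𝕜 := ℂ)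

/-- The measure `A ↦ ⟪ψ, E(A) ψ⟫`; for a unit vector `ψ` this is the probability law, in the
state `ψ`, of the observable with spectral measure `E`. -/
def law (E : ProjectionMeasure H) (ψ : H) : Measure ℝ :=
  Measure.ofMeasurable (fun A _ => ENNReal.ofReal (⟪ψ, E.proj A ψ⟫_ℂ).re)
    (by simp [E.proj_empty])
    (by
      intro A hA hd
      have h := E.hasSum_iUnion A hA hd ψ
      have h1 : HasSum (fun n => (⟪ψ, E.proj (A n) ψ⟫_ℂ).re)
          (⟪ψ, E.proj (⋃ n, A n) ψ⟫_ℂ).re :=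
        Complex.hasSum_re (h.mapL (innerSL ℂ ψ))
      rw [← h1.tsum_eq]
      exact ENNReal.ofReal_tsum_of_nonneg (fun n => E.inner_proj (hA n) ψ) h1.summable)

theorem law_apply (E : ProjectionMeasure H) (ψ : H) {A : Set ℝ} (hA : MeasurableSet A) :
    E.law ψ A = ENNReal.ofReal (⟪ψ, E.proj A ψ⟫_ℂ).re :=
  Measure.ofMeasurable_apply A hA

/-- `T = ∫ x dE(x)`: the domain of `T` consists of the vectors `ψ` with
`∫ x² d⟪ψ, E(x) ψ⟫ < ∞`, and `⟪ψ, T ψ⟫ = ∫ x d⟪ψ, E(x) ψ⟫` on it. By the spectral theorem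
each self-adjoint `T` has exactly one such `E`. -/
def IsSpectralMeasureOf (E : ProjectionMeasure H) (T : H →ₗ.[ℂ] H) : Prop :=
  (∀ ψ : H, ψ ∈ T.domain ↔ Integrable (fun x : ℝ => x ^ 2) (E.law ψ)) ∧
  ∀ ψ : T.domain, ⟪(ψ : H), T ψ⟫_ℂ = ((∫ x, x ∂(E.law ψ) : ℝ) : ℂ)

end ProjectionMeasure

end Spectral

/-! ### The Heisenberg Fock space -/

/-- The Heisenberg Fock space, as `ℓ²(ℕ)` in the number basis. By `inner_expVec` and
`span_expVec` below it is the Hilbert space completion of the span of the exponential vectors. -/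
abbrev Fock : Type := lp (fun _ : ℕ => ℂ) 2

theorem memlp_of_rapid {c : ℕ → ℂ}
    (h : ∀ k : ℕ, Summable fun n : ℕ => (n : ℝ) ^ k * ‖c n‖ ^ 2) :
    Memℓp (E := fun _ : ℕ => ℂ) c 2 := by
  apply memℓp_gen
  simpa using h 0

/-- The dense domain of vectors with rapidly decreasing coefficients. It contains the number
vectors and the exponential vectors, and is invariant under annihilation and creation. -/
def smooth : Submodule ℂ Fock where
  carrier := {f | ∀ k : ℕ, Summable fun n : ℕ => (n : ℝ) ^ k * ‖f n‖ ^ 2}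
  zero_mem' := by
    intro k
    simp
  add_mem' := by
    intro f g hf hg k
    refine Summable.of_nonneg_of_le (fun n => by positivity) (fun n => ?_)
      (((hf k).add (hg k)).mul_left 2)
    have h1 : ‖f n + g n‖ ≤ ‖f n‖ + ‖g n‖ := norm_add_le _ _
    have h2 : ‖f n + g n‖ ^ 2 ≤ 2 * (‖f n‖ ^ 2 + ‖g n‖ ^ 2) := by
      nlinarith [norm_nonneg (f n + g n), sq_nonneg (‖f n‖ - ‖g n‖),
        norm_nonneg (f n), norm_nonneg (g n)]
    have h3 : (0 : ℝ) ≤ (n : ℝ) ^ k := by positivity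
    calc (n : ℝ) ^ k * ‖f n + g n‖ ^ 2
        ≤ (n : ℝ) ^ k * (2 * (‖f n‖ ^ 2 + ‖g n‖ ^ 2)) := by gcongr
      _ = _ := by ring
  smul_mem' := by
    intro c f hf k
    refine ((hf k).mul_left (‖c‖ ^ 2)).congr (fun n => ?_)
    simp only [lp.coeFn_smul, Pi.smul_apply, norm_smul]
    ring

/-- The element of the domain with given rapidly decreasing coefficients. -/
def mkSmooth (c : ℕ → ℂ) (h : ∀ k : ℕ, Summable fun n : ℕ => (n : ℝ) ^ k * ‖c n‖ ^ 2) : smooth :=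
  ⟨⟨c, memlp_of_rapid h⟩, h⟩

theorem rapid_annih (f : smooth) (k : ℕ) :
    Summable fun n : ℕ => (n : ℝ) ^ k * ‖(√((n : ℝ) + 1) : ℂ) * (f : Fock) (n + 1)‖ ^ 2 := by
  have h := (summable_nat_add_iff 1).2 (f.2 (k + 1))
  refine Summable.of_nonneg_of_le (fun n => by positivity) (fun n => ?_) h
  have h0 : (0 : ℝ) ≤ (n : ℝ) + 1 := by positivity
  rw [norm_mul, mul_pow, Complex.norm_real, Real.norm_eq_abs, sq_abs, Real.sq_sqrt h0]
  push_cast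
  have h1 : (n : ℝ) ^ k ≤ ((n : ℝ) + 1) ^ k := by gcongr; linarith
  calc (n : ℝ) ^ k * (((n : ℝ) + 1) * ‖(f : Fock) (n + 1)‖ ^ 2)
      ≤ ((n : ℝ) + 1) ^ k * (((n : ℝ) + 1) * ‖(f : Fock) (n + 1)‖ ^ 2) := by gcongr
    _ = _ := by ring

theorem rapid_create (f : smooth) (k : ℕ) :
    Summable fun n : ℕ => (n : ℝ) ^ k * ‖(√(n : ℝ) : ℂ) * (f : Fock) (n - 1)‖ ^ 2 := by
  rw [← summable_nat_add_iff 1]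
  have h := (((f.2 (k + 1)).add (f.2 0)).mul_left (2 ^ (k + 1)))
  refine Summable.of_nonneg_of_le (fun n => by positivity) (fun n => ?_) h
  have h0 : (0 : ℝ) ≤ (n : ℝ) + 1 := by positivity
  rw [norm_mul, mul_pow, Complex.norm_real, Real.norm_eq_abs, sq_abs]
  push_cast
  rw [Real.sq_sqrt h0]
  show (n + 1 : ℝ) ^ k * ((n + 1) * ‖(f : Fock) n‖ ^ 2) ≤ _
  have h1 : ((n : ℝ) + 1) ^ (k + 1) ≤ 2 ^ (k + 1) * ((n : ℝ) ^ (k + 1) + 1) := by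
    rcases Nat.eq_zero_or_pos n with rfl | hn
    · have : (1 : ℝ) ≤ 2 ^ (k + 1) := one_le_pow₀ (by norm_num)
      simpa using this
    · have hn' : (1 : ℝ) ≤ n := by exact_mod_cast hn
      calc ((n : ℝ) + 1) ^ (k + 1) ≤ (2 * n) ^ (k + 1) := by gcongr; linarith
        _ = 2 ^ (k + 1) * (n : ℝ) ^ (k + 1) := mul_pow _ _ _
        _ ≤ _ := by gcongr; linarith
  calc ((n : ℝ) + 1) ^ k * (((n : ℝ) + 1) * ‖(f : Fock) n‖ ^ 2)
      = ((n : ℝ) + 1) ^ (k + 1) * ‖(f : Fock) n‖ ^ 2 := by ring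
    _ ≤ 2 ^ (k + 1) * ((n : ℝ) ^ (k + 1) + 1) * ‖(f : Fock) n‖ ^ 2 := by gcongr
    _ = _ := by ring

/-- The annihilation operator, `(b f)ₙ = √(n+1) fₙ₊₁`. -/
def b : Module.End ℂ smooth where
  toFun f := mkSmooth (fun n => (√((n : ℝ) + 1) : ℂ) * (f : Fock) (n + 1)) (rapid_annih f)
  map_add' f g := by
    apply Subtype.ext
    apply lp.ext
    funext n
    exact mul_add _ _ _
  map_smul' c f := by
    apply Subtype.ext
    apply lp.ext
    funext n
    exact mul_left_comm _ _ _

/-- The creation operator, `(b† f)₀ = 0` and `(b† f)ₙ = √n fₙ₋₁`. -/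
def bdag : Module.End ℂ smooth where
  toFun f := mkSmooth (fun n => (√(n : ℝ) : ℂ) * (f : Fock) (n - 1)) (rapid_create f)
  map_add' f g := by
    apply Subtype.ext
    apply lp.ext
    funext n
    exact mul_add _ _ _
  map_smul' c f := by
    apply Subtype.ext
    apply lp.ext
    funext n
    exact mul_left_comm _ _ _

theorem b_apply (f : smooth) (n : ℕ) :
    (b f : Fock) n = (√((n : ℝ) + 1) : ℂ) * (f : Fock) (n + 1) := rfl

theorem bdag_apply (f : smooth) (n : ℕ) :
    (bdag f : Fock) n = (√(n : ℝ) : ℂ) * (f : Fock) (n - 1) := rfl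

/-- `[b, b†] = 1`. -/
theorem ccr : b * bdag - bdag * b = 1 := by
  apply LinearMap.ext
  intro f
  apply Subtype.ext
  apply lp.ext
  funext n
  have e : ∀ m : ℕ, (√((m : ℝ) + 1) : ℂ) * (√((m : ℝ) + 1) : ℂ) = (m : ℂ) + 1 := by
    intro m
    rw [← Complex.ofReal_mul, Real.mul_self_sqrt (by positivity)]
    push_cast
    ring
  change (b (bdag f) : Fock) n - (bdag (b f) : Fock) n = (f : Fock) n
  rcases n with _ | n
  · rw [b_apply, bdag_apply, bdag_apply]
    simp
  · rw [b_apply, bdag_apply, bdag_apply, b_apply]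
    have e1 := e (n + 1)
    have e2 := e n
    simp only [Nat.add_sub_cancel]
    push_cast at e1 e2 ⊢
    linear_combination ((f : Fock) (n + 1)) * e1 - ((f : Fock) (n + 1)) * e2

theorem rapid_exp (c : ℂ) (k : ℕ) :
    Summable fun n : ℕ => (n : ℝ) ^ k * ‖c ^ n / (√(n.factorial : ℝ) : ℂ)‖ ^ 2 := by
  have h : Summable fun n : ℕ => (n : ℝ) ^ k * ((‖c‖ ^ 2) ^ n / (n.factorial : ℝ)) := by
    have h1 := Real.summable_pow_div_factorial (Real.exp k * ‖c‖ ^ 2)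
    refine Summable.of_nonneg_of_le (fun n => by positivity) (fun n => ?_) h1
    have h2 : (n : ℝ) ^ k ≤ Real.exp k ^ n := by
      calc (n : ℝ) ^ k ≤ (Real.exp n) ^ k := by
            gcongr
            linarith [Real.add_one_le_exp (n : ℝ)]
        _ = Real.exp k ^ n := by
            rw [← Real.exp_nat_mul, ← Real.exp_nat_mul, mul_comm]
    rw [mul_pow, mul_div_assoc]
    gcongr
  refine h.congr (fun n => ?_)
  rw [norm_div, div_pow, Complex.norm_real, Real.norm_eq_abs, sq_abs,
    Real.sq_sqrt (by positivity), norm_pow, ← pow_mul, ← pow_mul, mul_comm n 2]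

/-- The exponential vector `y(c)`. -/
def expVec (c : ℂ) : smooth :=
  mkSmooth (fun n => c ^ n / (√(n.factorial : ℝ) : ℂ)) (rapid_exp c)

theorem expVec_apply (c : ℂ) (n : ℕ) :
    (expVec c : Fock) n = c ^ n / (√(n.factorial : ℝ) : ℂ) := rfl

theorem inner_expVec (c d : ℂ) :
    ⟪(expVec c : Fock), (expVec d : Fock)⟫_ℂ = Complex.exp (conj c * d) := by
  rw [lp.inner_eq_tsum, Complex.exp_eq_exp_ℂ, NormedSpace.exp_eq_tsum_div]
  congr 1
  funext n
  have e : (√(n.factorial : ℝ) : ℂ) * (√(n.factorial : ℝ) : ℂ) = (n.factorial : ℂ) := by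
    rw [← Complex.ofReal_mul, Real.mul_self_sqrt (by positivity)]
    simp
  simp only [expVec_apply, RCLike.inner_apply, map_div₀, map_pow, Complex.conj_ofReal]
  rw [div_mul_div_comm, e, mul_pow, mul_comm]

theorem span_expVec :
    (Submodule.span ℂ (Set.range fun c : ℂ => (expVec c : Fock))).topologicalClosure = ⊤ := by
  rw [Submodule.topologicalClosure_eq_top_iff, Submodule.eq_bot_iff]
  intro g hg
  rw [Submodule.mem_orthogonal] at hg
  have h0 : ∀ c : ℂ, HasSum (fun n : ℕ => c ^ n • (g n / (√(n.factorial : ℝ) : ℂ))) 0 := by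
    intro c
    have h1 := hg (expVec (conj c) : Fock) (Submodule.subset_span ⟨conj c, rfl⟩)
    have h2 := lp.hasSum_inner (𝕜 := ℂ) (expVec (conj c) : Fock) g
    rw [h1] at h2
    have h3 : (fun n : ℕ => c ^ n • (g n / (√(n.factorial : ℝ) : ℂ))) =
        fun n : ℕ => ⟪(expVec (conj c) : Fock) n, g n⟫_ℂ := by
      funext n
      rw [expVec_apply, RCLike.inner_apply, map_div₀, map_pow, Complex.conj_ofReal,
        Complex.conj_conj, smul_eq_mul]
      ring
    rw [h3]
    exact h2
  let p : FormalMultilinearSeries ℂ ℂ ℂ := fun n =>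
    ContinuousMultilinearMap.mkPiRing ℂ (Fin n) (g n / (√(n.factorial : ℝ) : ℂ))
  have hp : HasFPowerSeriesAt (0 : ℂ → ℂ) p 0 := by
    rw [hasFPowerSeriesAt_iff]
    refine Filter.Eventually.of_forall (fun c => ?_)
    simpa [p, FormalMultilinearSeries.coeff] using h0 c
  have hp0 := hp.eq_zero
  apply lp.ext
  funext n
  have h1 : p.coeff n = 0 := by rw [hp0]; rfl
  have h2 : (√(n.factorial : ℝ) : ℂ) ≠ 0 := by
    rw [Complex.ofReal_ne_zero]
    positivity
  simpa [p, FormalMultilinearSeries.coeff, Nat.factorial_ne_zero] using h1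

/-- `b y(c) = c y(c)`. -/
theorem b_expVec (c : ℂ) : b (expVec c) = c • expVec c := by
  apply Subtype.ext
  apply lp.ext
  funext n
  have h0 : (√((n : ℝ) + 1) : ℂ) ≠ 0 := by
    rw [Complex.ofReal_ne_zero]
    positivity
  have h1 : (√(n.factorial : ℝ) : ℂ) ≠ 0 := by
    rw [Complex.ofReal_ne_zero]
    positivity
  change (b (expVec c) : Fock) n = c * (expVec c : Fock) n
  rw [b_apply, expVec_apply, expVec_apply, Nat.factorial_succ]
  push_cast
  rw [Real.sqrt_mul (by positivity), pow_succ]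
  push_cast
  field_simp

/-- `b†` is the formal adjoint of `b`. -/
theorem inner_bdag (f g : smooth) :
    ⟪(bdag f : Fock), (g : Fock)⟫_ℂ = ⟪(f : Fock), (b g : Fock)⟫_ℂ := by
  rw [lp.inner_eq_tsum, lp.inner_eq_tsum,
    (lp.summable_inner (𝕜 := ℂ) (bdag f : Fock) (g : Fock)).tsum_eq_zero_add]
  have h0 : ⟪(bdag f : Fock) 0, (g : Fock) 0⟫_ℂ = 0 := by
    rw [bdag_apply]
    simp
  rw [h0, zero_add]
  congr 1
  funext n
  rw [bdag_apply, b_apply]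
  simp only [RCLike.inner_apply, map_mul, Complex.conj_ofReal, Nat.add_sub_cancel]
  push_cast
  ring

/-- The vacuum vector `Φ = y(0)`. -/
def vacuum : Fock := expVec 0

/-! ### The boson Fock representation of the centrally extended Heisenberg algebra -/

open Complex in
/-- The operator `a`. -/
def a (z : ℂ) (ρ r : ℝ) : Module.End ℂ smooth :=
  if z.re = 0 then
    ((ρ : ℂ) - I * z.im / (16 * r ^ 2)) • (b - bdag) ^ 2 + (r : ℂ) • (b + bdag)
  else
    ((4 * ρ * z.im - r ^ 2) / (4 * z.re) + I * ρ : ℂ) • (b - bdag) ^ 2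
      - (I * conj z / (2 * r)) • (b + bdag)

open Complex in
/-- The operator `a†`. -/
def adag (z : ℂ) (ρ r : ℝ) : Module.End ℂ smooth :=
  if z.re = 0 then
    ((ρ : ℂ) + I * z.im / (16 * r ^ 2)) • (b - bdag) ^ 2 + (r : ℂ) • (b + bdag)
  else
    ((4 * ρ * z.im - r ^ 2) / (4 * z.re) - I * ρ : ℂ) • (b - bdag) ^ 2
      + (I * z / (2 * r)) • (b + bdag)

open Complex in
/-- The operator `h`. -/
def h (z : ℂ) (r : ℝ) : Module.End ℂ smooth :=
  if z.re = 0 then (I * z.im / (2 * r)) • (bdag - b)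
  else (I * r) • (bdag - b)

/-- The closure of `a + a† + h`. -/
def X (z : ℂ) (ρ r : ℝ) : Fock →ₗ.[ℂ] Fock :=
  LinearPMap.closure ⟨smooth, smooth.subtype ∘ₗ (a z ρ r + adag z ρ r + h z r)⟩

/-- The real constant `L`. -/
def L (z : ℂ) (ρ r : ℝ) : ℝ :=
  if z.re = 0 then 2 * ρ else (4 * ρ * z.im - r ^ 2) / (2 * z.re)

open Complex in
/-- The complex constant `M`. -/
def M (z : ℂ) (r : ℝ) : ℂ :=
  if z.re = 0 then 2 * r - I * (z.im / (2 * r)) else -(z.im / r + I * r)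

open Complex in
/-- The complex constant `N`. -/
def N (z : ℂ) (r : ℝ) : ℂ :=
  if z.re = 0 then 2 * r + I * (z.im / (2 * r)) else -(z.im / r - I * r)

end CEHeis

end

/-! In all cases `a + a† + h` equals `l (b - b†)² + k b + k̄ b†` with `l = L`, `k = M` and `N = k̄`
(`a_add_adag_add_h`), so everything is about the operator `quadOp l k`.

Send the number vectors to Hermite functions carrying the phases `(-i)ⁿ`. On functions of `x` with
ground state `(2π)^(-1/4) e^{-x²/4}`, `b` becomes `i(d/dx + x/2)` and `b†` becomes `i(d/dx - x/2)`,
so that `b - b†` is multiplication by `ix` and `quadOp l k` is `2i(Re k) d/dx - l x² - (Im k) x`. If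
`Re k = 0` this is a multiplication operator. Otherwise a phase `e^{iθ}` with a cubic polynomial `θ`
absorbs the multiplicative terms, and the Fourier transform turns the remaining `2i(Re k) d/dx` into
multiplication by `-4π(Re k)ξ` (`isMulOperator_of_re_eq_zero`, `isMulOperator_of_re_ne_zero`).

The intertwining is checked on number vectors only. It extends to the closure because `quadOp l k +
i` has dense range on their span: a deficiency vector satisfies a five-term recurrence whose flux
through level `K` grows at most like `K` times a summable sequence, which forces it to vanish
(`deficiency_eq_zero`, `isMulOperator_closure`). This gives a spectral measure.

The formula is claimed for every `E` satisfying `IsSpectralMeasureOf`, which prescribes only the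
domain and the quadratic form. Hence a uniqueness statement is needed: `law_eq` shows that each law
under `E` is the push-forward of `|Uψ|²` by the multiplier.

For the vacuum and `Re k ≠ 0`, `∫ e^{-4πs(Re k)ξ} |f̂(ξ)|² dξ` is, by a contour shift and
Plancherel, `∫ |f(x + i s Re k)|² dx` with `f` the ground state times `e^{iθ}`. The shifted
integrand is Gaussian with leading coefficient `-(1 + 2ls)/2`; the condition `2Ls + 1 > 0` is its
integrability. For `Re k = 0` the Gaussian integral appears directly (`vacuum_mgf`). -/

namespace CEHeis

open Filter Topology ENNReal NNReal

/-! ### Projection-valued measures of multiplication operators -/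

section Multiplication

variable {Ω : Type*} [MeasurableSpace Ω] {ν : Measure Ω}

/-- Multiplication by the indicator function of a measurable set on `L²`. -/
noncomputable def indicatorCLM {B : Set Ω} (hB : MeasurableSet B) : Lp ℂ 2 ν →L[ℂ] Lp ℂ 2 ν :=
  LinearMap.mkContinuous
    { toFun := fun f => ((Lp.memLp f).indicator hB).toLp
      map_add' := by
        intro f g
        rw [← MemLp.toLp_add]
        apply MemLp.toLp_congr
        filter_upwards [Lp.coeFn_add f g] with x hx
        by_cases hxB : x ∈ B
        · simp only [Pi.add_apply, Set.indicator_of_mem hxB, hx]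
        · simp only [Pi.add_apply, Set.indicator_of_notMem hxB, add_zero]
      map_smul' := by
        intro c f
        rw [RingHom.id_apply, ← MemLp.toLp_const_smul]
        apply MemLp.toLp_congr
        filter_upwards [Lp.coeFn_smul c f] with x hx
        by_cases hxB : x ∈ B
        · simp only [Pi.smul_apply, Set.indicator_of_mem hxB, hx]
        · simp only [Pi.smul_apply, Set.indicator_of_notMem hxB, smul_zero] } 1 (by
      intro f
      rw [one_mul]
      simp only [LinearMap.coe_mk, AddHom.coe_mk, Lp.norm_toLp]
      rw [Lp.norm_def]
      exact ENNReal.toReal_mono (Lp.eLpNorm_ne_top f) (eLpNorm_indicator_le _))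

theorem indicatorCLM_apply {B : Set Ω} (hB : MeasurableSet B) (f : Lp ℂ 2 ν) :
    indicatorCLM hB f = ((Lp.memLp f).indicator hB).toLp := rfl

theorem indicatorCLM_coeFn {B : Set Ω} (hB : MeasurableSet B) (f : Lp ℂ 2 ν) :
    ⇑(indicatorCLM hB f) =ᵐ[ν] B.indicator f := by
  rw [indicatorCLM_apply]
  exact MemLp.coeFn_toLp _

theorem indicatorCLM_univ : indicatorCLM (ν := ν) (MeasurableSet.univ : MeasurableSet (Set.univ : Set Ω)) = 1 := by
  ext1 f
  apply Lp.ext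
  filter_upwards [indicatorCLM_coeFn MeasurableSet.univ f] with x hx
  simp [hx]

theorem indicatorCLM_mul {A B : Set Ω} (hA : MeasurableSet A) (hB : MeasurableSet B) :
    indicatorCLM (ν := ν) (hA.inter hB) = indicatorCLM hA * indicatorCLM hB := by
  ext1 f
  apply Lp.ext
  filter_upwards [indicatorCLM_coeFn (hA.inter hB) f, indicatorCLM_coeFn hB f,
    indicatorCLM_coeFn hA (indicatorCLM hB f)] with x h1 h2 h3
  rw [mul_apply_eq_comp, h1, h3]
  by_cases hxA : x ∈ A <;> by_cases hxB : x ∈ B <;> simp [hxA, hxB, h2]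

theorem inner_indicatorCLM {B : Set Ω} (hB : MeasurableSet B) (f g : Lp ℂ 2 ν) :
    ⟪indicatorCLM hB f, g⟫_ℂ = ⟪f, indicatorCLM hB g⟫_ℂ := by
  rw [L2.inner_def, L2.inner_def]
  apply integral_congr_ae
  filter_upwards [indicatorCLM_coeFn hB f, indicatorCLM_coeFn hB g] with x h1 h2
  rw [h1, h2]
  by_cases hxB : x ∈ B <;> simp [hxB]

theorem indicatorCLM_isStarProjection {B : Set Ω} (hB : MeasurableSet B) :
    IsStarProjection (indicatorCLM (ν := ν) hB) where
  isIdempotentElem := by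
    rw [IsIdempotentElem, ← indicatorCLM_mul hB hB]
    congr 1
    simp
  isSelfAdjoint := by
    rw [ContinuousLinearMap.isSelfAdjoint_iff_isSymmetric]
    exact inner_indicatorCLM hB

/-- The measure with density `‖f‖²`. -/
noncomputable def sqMeasure (f : Lp ℂ 2 ν) : Measure Ω :=
  ν.withDensity fun x => ((‖f x‖₊ ^ 2 : ℝ≥0) : ℝ≥0∞)

theorem measurable_nnnorm_sq (f : Lp ℂ 2 ν) : Measurable fun x => ‖f x‖₊ ^ 2 :=
  ((Lp.stronglyMeasurable f).measurable.nnnorm).pow_const 2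

theorem integrable_norm_sq (f : Lp ℂ 2 ν) : Integrable (fun x => ‖f x‖ ^ 2) ν :=
  (memLp_two_iff_integrable_sq_norm (Lp.aestronglyMeasurable f)).1 (Lp.memLp f)

theorem sqMeasure_apply (f : Lp ℂ 2 ν) {B : Set Ω} (hB : MeasurableSet B) :
    sqMeasure f B = ENNReal.ofReal (∫ x in B, ‖f x‖ ^ 2 ∂ν) := by
  rw [sqMeasure, withDensity_apply _ hB, ofReal_integral_eq_lintegral_ofReal
    (integrable_norm_sq f).integrableOn (Eventually.of_forall fun x => by positivity)]
  congr 1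
  funext x
  rw [ENNReal.ofReal_pow (norm_nonneg _), ofReal_norm, enorm_eq_nnnorm]
  simp

instance (f : Lp ℂ 2 ν) : IsFiniteMeasure (sqMeasure f) :=
  ⟨by rw [sqMeasure_apply f MeasurableSet.univ]; exact ENNReal.ofReal_lt_top⟩

theorem inner_indicatorCLM_self {B : Set Ω} (hB : MeasurableSet B) (f : Lp ℂ 2 ν) :
    ⟪f, indicatorCLM hB f⟫_ℂ = ((∫ x in B, ‖f x‖ ^ 2 ∂ν : ℝ) : ℂ) := by
  rw [L2.inner_def, ← integral_indicator hB, ← integral_complex_ofReal]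
  apply integral_congr_ae
  filter_upwards [indicatorCLM_coeFn hB f] with x h1
  rw [h1]
  by_cases hxB : x ∈ B
  · simp [hxB]
  · simp [hxB]

variable {H : Type*} [NormedAddCommGroup H] [InnerProductSpace ℂ H] [CompleteSpace H]

open Classical in
/-- The values of the spectral measure of the multiplication operator by `m`, transported
by a unitary `U`. -/
noncomputable def mulProj (U : H ≃ₗᵢ[ℂ] Lp ℂ 2 ν) (m : Ω → ℝ) (A : Set ℝ) : H →L[ℂ] H :=
  if hA : MeasurableSet (m ⁻¹' A) then
    (U.symm.toContinuousLinearEquiv : Lp ℂ 2 ν →L[ℂ] H) ∘L indicatorCLM hA ∘L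
      (U.toContinuousLinearEquiv : H →L[ℂ] Lp ℂ 2 ν)
  else 0

theorem mulProj_apply (U : H ≃ₗᵢ[ℂ] Lp ℂ 2 ν) (m : Ω → ℝ) {A : Set ℝ}
    (hA : MeasurableSet (m ⁻¹' A)) (ψ : H) :
    mulProj U m A ψ = U.symm (indicatorCLM hA (U ψ)) := by
  rw [mulProj, dif_pos hA]
  rfl

theorem map_mulProj_apply (U : H ≃ₗᵢ[ℂ] Lp ℂ 2 ν) (m : Ω → ℝ) {A : Set ℝ}
    (hA : MeasurableSet (m ⁻¹' A)) (ψ : H) :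
    U (mulProj U m A ψ) = indicatorCLM hA (U ψ) := by
  rw [mulProj_apply U m hA, LinearIsometryEquiv.apply_symm_apply]

theorem inner_mulProj_self (U : H ≃ₗᵢ[ℂ] Lp ℂ 2 ν) (m : Ω → ℝ) {A : Set ℝ}
    (hA : MeasurableSet (m ⁻¹' A)) (ψ : H) :
    (⟪ψ, mulProj U m A ψ⟫_ℂ).re = ∫ x in m ⁻¹' A, ‖U ψ x‖ ^ 2 ∂ν := by
  rw [← U.inner_map_map, map_mulProj_apply U m hA, inner_indicatorCLM_self, Complex.ofReal_re]

theorem mulProj_isStarProjection (U : H ≃ₗᵢ[ℂ] Lp ℂ 2 ν) (m : Ω → ℝ) {A : Set ℝ}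
    (hA : MeasurableSet (m ⁻¹' A)) : IsStarProjection (mulProj U m A) where
  isIdempotentElem := by
    ext1 ψ
    apply U.injective
    rw [mul_apply_eq_comp, map_mulProj_apply U m hA, map_mulProj_apply U m hA]
    exact congrArg (fun T : Lp ℂ 2 ν →L[ℂ] Lp ℂ 2 ν => T (U ψ))
      (indicatorCLM_isStarProjection hA).isIdempotentElem.eq
  isSelfAdjoint := by
    rw [ContinuousLinearMap.isSelfAdjoint_iff_isSymmetric]
    intro φ ψ
    change ⟪mulProj U m A φ, ψ⟫_ℂ = ⟪φ, mulProj U m A ψ⟫_ℂ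
    rw [← U.inner_map_map, ← U.inner_map_map φ, map_mulProj_apply U m hA,
      map_mulProj_apply U m hA, inner_indicatorCLM]

theorem norm_sq_apply_of_isStarProjection {P : H →L[ℂ] H} (hP : IsStarProjection P) (ψ : H) :
    ‖P ψ‖ ^ 2 = (⟪ψ, P ψ⟫_ℂ).re := by
  have h1 : P (P ψ) = P ψ := congrArg (fun T : H →L[ℂ] H => T ψ) hP.isIdempotentElem.eq
  have h2 := (ContinuousLinearMap.isSelfAdjoint_iff_isSymmetric.1 hP.isSelfAdjoint) ψ (P ψ)
  change ⟪P ψ, P ψ⟫_ℂ = ⟪ψ, P (P ψ)⟫_ℂ at h2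
  rw [h1] at h2
  rw [← h2, inner_self_eq_norm_sq_to_K]
  norm_cast

/-- Strong countable additivity from weak countable additivity. -/
theorem hasSum_proj_of_hasSum_inner {P : ℕ → H →L[ℂ] H} {Q : H →L[ℂ] H}
    (hP : ∀ n, IsStarProjection (P n)) (hQ : IsStarProjection Q)
    (hQP : ∀ n, Q * P n = P n) (hPP : ∀ i j, i ≠ j → P i * P j = 0) (ψ : H)
    (hs : HasSum (fun n => (⟪ψ, P n ψ⟫_ℂ).re) (⟪ψ, Q ψ⟫_ℂ).re) :
    HasSum (fun n => P n ψ) (Q ψ) := by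
  have hsym : ∀ {R : H →L[ℂ] H}, IsStarProjection R → ∀ x y, ⟪R x, y⟫_ℂ = ⟪x, R y⟫_ℂ :=
    fun hR x y => (ContinuousLinearMap.isSelfAdjoint_iff_isSymmetric.1 hR.isSelfAdjoint) x y
  -- Pythagoras: the squared remainder is exactly the defect of the scalar series, so weak
  -- convergence gives norm convergence.
  have key : ∀ s : Finset ℕ, ‖Q ψ - ∑ n ∈ s, P n ψ‖ ^ 2 =
      (⟪ψ, Q ψ⟫_ℂ).re - ∑ n ∈ s, (⟪ψ, P n ψ⟫_ℂ).re := by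
    intro s
    induction s using Finset.induction_on with
    | empty => simpa using norm_sq_apply_of_isStarProjection hQ ψ
    | insert k s hk ih =>
      have horth : ⟪P k ψ, ∑ n ∈ s, P n ψ⟫_ℂ = 0 := by
        rw [inner_sum]
        refine Finset.sum_eq_zero fun n hn => ?_
        rw [hsym (hP k)]
        have := congrArg (fun T : H →L[ℂ] H => T ψ) (hPP k n (fun h => hk (h ▸ hn)))
        simp only [mul_apply_eq_comp, zero_apply] at this
        rw [this, inner_zero_right]
      have hq : ⟪Q ψ, P k ψ⟫_ℂ = ⟪ψ, P k ψ⟫_ℂ := by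
        rw [hsym hQ]
        have := congrArg (fun T : H →L[ℂ] H => T ψ) (hQP k)
        simp only [mul_apply_eq_comp] at this
        rw [this]
      have h1 : (⟪Q ψ - ∑ n ∈ s, P n ψ, P k ψ⟫_ℂ).re = (⟪ψ, P k ψ⟫_ℂ).re := by
        rw [inner_sub_left, hq, ← inner_conj_symm (∑ n ∈ s, P n ψ), horth]
        simp
      have h2 := norm_sub_sq (𝕜 := ℂ) (Q ψ - ∑ n ∈ s, P n ψ) (P k ψ)
      rw [Finset.sum_insert hk, Finset.sum_insert hk,
        show Q ψ - (P k ψ + ∑ n ∈ s, P n ψ) = Q ψ - ∑ n ∈ s, P n ψ - P k ψ by abel, h2, ih,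
        norm_sq_apply_of_isStarProjection (hP k)]
      change _ - 2 * (⟪Q ψ - ∑ n ∈ s, P n ψ, P k ψ⟫_ℂ).re + _ = _
      rw [h1]
      ring
  rw [HasSum, tendsto_iff_norm_sub_tendsto_zero]
  have h3 : Tendsto (fun s : Finset ℕ => ‖Q ψ - ∑ n ∈ s, P n ψ‖ ^ 2) atTop (𝓝 0) := by
    simp_rw [key]
    have := (tendsto_const_nhds (x := (⟪ψ, Q ψ⟫_ℂ).re)).sub hs
    simpa using this
  have h4 := h3.sqrt
  simpa [Real.sqrt_sq, norm_sub_rev] using h4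

/-- The spectral measure of the multiplication operator by `m`, transported by `U`. -/
noncomputable def mulProjectionMeasure (U : H ≃ₗᵢ[ℂ] Lp ℂ 2 ν) {m : Ω → ℝ} (hm : Measurable m) :
    ProjectionMeasure H where
  proj := mulProj U m
  isStarProjection A hA := mulProj_isStarProjection U m (hm hA)
  univ := by
    ext1 ψ
    apply U.injective
    rw [map_mulProj_apply U m (hm MeasurableSet.univ)]
    exact congrArg (fun T : Lp ℂ 2 ν →L[ℂ] Lp ℂ 2 ν => T (U ψ)) indicatorCLM_univ
  inter A B hA hB := by
    ext1 ψ
    apply U.injective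
    rw [map_mulProj_apply U m (hm (hA.inter hB)), mul_apply_eq_comp,
      map_mulProj_apply U m (hm hA), map_mulProj_apply U m (hm hB)]
    exact congrArg (fun T : Lp ℂ 2 ν →L[ℂ] Lp ℂ 2 ν => T (U ψ)) (indicatorCLM_mul (hm hA) (hm hB))
  hasSum_iUnion A hA hd ψ := by
    have hinter : ∀ S T : Set ℝ, MeasurableSet S → MeasurableSet T →
        mulProj U m S * mulProj U m T = mulProj U m (S ∩ T) := by
      intro S T hS hT
      ext1 ψ
      apply U.injective
      rw [map_mulProj_apply U m (hm (hS.inter hT)), mul_apply_eq_comp,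
        map_mulProj_apply U m (hm hS), map_mulProj_apply U m (hm hT)]
      exact (congrArg (fun T : Lp ℂ 2 ν →L[ℂ] Lp ℂ 2 ν => T (U ψ))
        (indicatorCLM_mul (hm hS) (hm hT))).symm
    have hU : MeasurableSet (⋃ n, A n) := MeasurableSet.iUnion hA
    refine hasSum_proj_of_hasSum_inner (fun n => mulProj_isStarProjection U m (hm (hA n)))
      (mulProj_isStarProjection U m (hm hU)) (fun n => ?_) (fun i j hij => ?_) ψ ?_
    · rw [hinter _ _ hU (hA n), Set.inter_eq_right.2 (Set.subset_iUnion A n)]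
    · rw [hinter _ _ (hA i) (hA j), Set.disjoint_iff_inter_eq_empty.1 (hd hij)]
      ext1 φ
      apply U.injective
      rw [map_mulProj_apply U m (hm MeasurableSet.empty)]
      apply Lp.ext
      filter_upwards [indicatorCLM_coeFn (hm MeasurableSet.empty) (U φ),
        Lp.coeFn_zero ℂ 2 ν] with x h1 h2
      rw [h1, zero_apply, map_zero, h2]
      simp
    · rw [inner_mulProj_self U m (hm hU)]
      simp_rw [fun n => inner_mulProj_self U m (hm (hA n)) ψ]
      rw [Set.preimage_iUnion]
      exact hasSum_integral_iUnion (fun n => hm (hA n))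
        (fun i j hij => (hd hij).preimage m) (integrable_norm_sq _).integrableOn

theorem mulProjectionMeasure_law (U : H ≃ₗᵢ[ℂ] Lp ℂ 2 ν) {m : Ω → ℝ} (hm : Measurable m) (ψ : H) :
    (mulProjectionMeasure U hm).law ψ = (sqMeasure (U ψ)).map m := by
  ext A hA
  rw [ProjectionMeasure.law_apply _ _ hA, Measure.map_apply hm hA, sqMeasure_apply _ (hm hA)]
  exact congrArg _ (inner_mulProj_self U m (hm hA) ψ)

theorem integrable_map_sqMeasure_iff (f : Lp ℂ 2 ν) {m : Ω → ℝ} (hm : Measurable m)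
    {g : ℝ → ℝ} (hg : Measurable g) :
    Integrable g ((sqMeasure f).map m) ↔ Integrable (fun x => ‖f x‖ ^ 2 * g (m x)) ν := by
  rw [integrable_map_measure hg.aestronglyMeasurable hm.aemeasurable, sqMeasure,
    integrable_withDensity_iff_integrable_smul (measurable_nnnorm_sq f)]
  apply integrable_congr
  filter_upwards with x
  simp [NNReal.smul_def]

theorem integral_map_sqMeasure (f : Lp ℂ 2 ν) {m : Ω → ℝ} (hm : Measurable m)
    {g : ℝ → ℝ} (hg : Measurable g) :
    ∫ x, g x ∂((sqMeasure f).map m) = ∫ x, ‖f x‖ ^ 2 * g (m x) ∂ν := by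
  rw [integral_map hm.aemeasurable hg.aestronglyMeasurable, sqMeasure,
    integral_withDensity_eq_integral_smul (measurable_nnnorm_sq f)]
  rfl

/-- `X` is the operator of multiplication by `m`, transported by `U`. -/
structure IsMulOperator (X : H →ₗ.[ℂ] H) (U : H ≃ₗᵢ[ℂ] Lp ℂ 2 ν) (m : Ω → ℝ) : Prop where
  mem_domain : ∀ ψ : H, ψ ∈ X.domain ↔ MemLp (fun x => (m x : ℂ) * U ψ x) 2 ν
  apply : ∀ ψ : X.domain, U (X ψ) =ᵐ[ν] fun x => (m x : ℂ) * U ψ x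

theorem memLp_mul_iff (f : Lp ℂ 2 ν) {m : Ω → ℝ} (hm : Measurable m) :
    MemLp (fun x => (m x : ℂ) * f x) 2 ν ↔ Integrable (fun x => ‖f x‖ ^ 2 * m x ^ 2) ν := by
  have h1 : AEStronglyMeasurable (fun x => (m x : ℂ) * f x) ν :=
    (Complex.measurable_ofReal.comp hm).aestronglyMeasurable.mul (Lp.aestronglyMeasurable f)
  rw [memLp_two_iff_integrable_sq_norm h1]
  apply integrable_congr
  filter_upwards with x
  rw [norm_mul, mul_pow, Complex.norm_real, Real.norm_eq_abs, sq_abs, mul_comm]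

/-- Both clauses become statements about `|Uψ|²` after pushing forward by `m`: square integrability
of `m · Uψ` for the domain, and `∫ m |Uψ|²` for the quadratic form. -/
theorem IsMulOperator.isSpectralMeasureOf {X : H →ₗ.[ℂ] H} {U : H ≃ₗᵢ[ℂ] Lp ℂ 2 ν} {m : Ω → ℝ}
    (h : IsMulOperator X U m) (hm : Measurable m) :
    (mulProjectionMeasure U hm).IsSpectralMeasureOf X := by
  constructor
  · intro ψ
    rw [h.mem_domain, memLp_mul_iff _ hm, mulProjectionMeasure_law,
      integrable_map_sqMeasure_iff _ hm (by fun_prop)]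
  · intro ψ
    rw [mulProjectionMeasure_law, integral_map_sqMeasure _ hm (g := fun x => x) measurable_id, ← U.inner_map_map,
      L2.inner_def, ← integral_complex_ofReal]
    apply integral_congr_ae
    filter_upwards [h.apply ψ] with x hx
    rw [hx, RCLike.inner_apply, mul_assoc, Complex.mul_conj, Complex.normSq_eq_norm_sq]
    push_cast
    ring

end Multiplication

end CEHeis

namespace CEHeis

open Filter Topology ENNReal NNReal

/-! ### Uniqueness of the spectral measure of a multiplication operator -/

section Uniqueness

/-- Two finite measures on the line of equal mass coincide if one is dominated by the other on
compact intervals. -/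
theorem measure_eq_of_Icc_le {μ μ' : Measure ℝ} [IsFiniteMeasure μ] [IsFiniteMeasure μ']
    (h1 : ∀ c d, μ (Set.Icc c d) ≤ μ' (Set.Icc c d)) (h2 : μ Set.univ = μ' Set.univ) : μ = μ' := by
  have hmono : ∀ s : ℕ → Set ℝ, Monotone s → (∀ n, ∃ c d, s n = Set.Icc c d) →
      μ (⋃ n, s n) ≤ μ' (⋃ n, s n) := by
    intro s hs hI
    refine le_of_tendsto_of_tendsto' (tendsto_measure_iUnion_atTop hs)
      (tendsto_measure_iUnion_atTop hs) fun n => ?_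
    obtain ⟨c, d, hcd⟩ := hI n
    simp only [Function.comp_apply, hcd, h1]
  have hIic : ∀ t : ℝ, μ (Set.Iic t) ≤ μ' (Set.Iic t) := by
    intro t
    have : Set.Iic t = ⋃ n : ℕ, Set.Icc (t - n) t := by
      ext x
      simp only [Set.mem_Iic, Set.mem_iUnion, Set.mem_Icc]
      refine ⟨fun hx => ?_, fun ⟨n, hn⟩ => hn.2⟩
      obtain ⟨n, hn⟩ := exists_nat_ge (t - x)
      exact ⟨n, by linarith, hx⟩
    rw [this]
    refine hmono _ (fun i j hij => Set.Icc_subset_Icc_left ?_) fun n => ⟨_, _, rfl⟩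
    have : (i : ℝ) ≤ j := by exact_mod_cast hij
    linarith
  have hIoi : ∀ t : ℝ, μ (Set.Ioi t) ≤ μ' (Set.Ioi t) := by
    intro t
    have : Set.Ioi t = ⋃ n : ℕ, Set.Icc (t + 1 / ((n : ℝ) + 1)) (t + n) := by
      ext x
      simp only [Set.mem_Ioi, Set.mem_iUnion, Set.mem_Icc]
      constructor
      · intro hx
        obtain ⟨n, hn⟩ := exists_nat_one_div_lt (sub_pos.2 hx)
        obtain ⟨k, hk⟩ := exists_nat_ge (x - t)
        refine ⟨max n k, ?_, ?_⟩
        · have : 1 / ((max n k : ℕ) + 1 : ℝ) ≤ 1 / ((n : ℝ) + 1) := by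
            gcongr
            exact le_max_left n k
          linarith
        · have : (k : ℝ) ≤ (max n k : ℕ) := by exact_mod_cast le_max_right n k
          linarith
      · rintro ⟨n, hn, -⟩
        have : 0 < 1 / ((n : ℝ) + 1) := by positivity
        linarith
    rw [this]
    refine hmono _ (fun i j hij => Set.Icc_subset_Icc ?_ ?_) fun n => ⟨_, _, rfl⟩
    · gcongr
    · gcongr
  -- Domination on the complementary open ray, with equal total mass, gives the reverse inequality
  -- on the closed ray.
  refine Measure.ext_of_Iic _ _ fun t => le_antisymm (hIic t) ?_
  rw [← Set.compl_Ioi, measure_compl measurableSet_Ioi (measure_ne_top _ _),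
    measure_compl measurableSet_Ioi (measure_ne_top _ _), h2]
  exact tsub_le_tsub_left (hIoi t) _

/-- A finite measure whose moments grow at most like `rᵏ` lives on `[-r, r]`. -/
theorem measure_abs_gt_eq_zero {μ : Measure ℝ} [IsFiniteMeasure μ] {lam r : ℝ} (hr : 0 ≤ r) {C : ℝ≥0∞}
    (hC : C ≠ ∞)
    (hk : ∀ k : ℕ, ∫⁻ x, ENNReal.ofReal (|x - lam| ^ (2 * k)) ∂μ ≤ ENNReal.ofReal (r ^ (2 * k)) * C) :
    μ {x | r < |x - lam|} = 0 := by
  have hset : {x : ℝ | r < |x - lam|} = ⋃ n : ℕ, {x : ℝ | r + 1 / ((n : ℝ) + 1) ≤ |x - lam|} := by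
    ext x
    simp only [Set.mem_ofPred_eq, Set.mem_iUnion]
    constructor
    · intro hx
      obtain ⟨n, hn⟩ := exists_nat_one_div_lt (sub_pos.2 hx)
      exact ⟨n, by linarith⟩
    · rintro ⟨n, hn⟩
      have : 0 < 1 / ((n : ℝ) + 1) := by positivity
      linarith
  rw [hset]
  refine measure_iUnion_null fun n => ?_
  set d : ℝ := r + 1 / ((n : ℝ) + 1) with hd
  have hd0 : 0 < d := by positivity
  have hrd : r < d := by
    have : 0 < 1 / ((n : ℝ) + 1) := by positivity
    linarith
  -- Chebyshev at level `d > r` with the moment of order `2k`; the bound decays geometrically in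
  -- `k`.
  have hb : ∀ k : ℕ, μ {x | d ≤ |x - lam|} ≤ ENNReal.ofReal ((r / d) ^ (2 * k)) * C := by
    intro k
    have h1 : ENNReal.ofReal (d ^ (2 * k)) * μ {x | d ≤ |x - lam|} ≤ ENNReal.ofReal (r ^ (2 * k)) * C := by
      refine le_trans ?_ (hk k)
      refine le_trans ?_ (mul_meas_ge_le_lintegral (by fun_prop) (ENNReal.ofReal (d ^ (2 * k))))
      gcongr
      intro hx
      apply ENNReal.ofReal_le_ofReal
      gcongr
    have h2 : ENNReal.ofReal ((r / d) ^ (2 * k)) = ENNReal.ofReal (r ^ (2 * k)) / ENNReal.ofReal (d ^ (2 * k)) := by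
      rw [div_pow, ENNReal.ofReal_div_of_pos (by positivity)]
    rw [h2, ← ENNReal.mul_div_right_comm, ENNReal.le_div_iff_mul_le (Or.inl (by simp; positivity))
      (Or.inl ENNReal.ofReal_ne_top), mul_comm]
    exact h1
  have hlim : Tendsto (fun k : ℕ => ENNReal.ofReal ((r / d) ^ (2 * k)) * C) atTop (𝓝 0) := by
    have h3 : Tendsto (fun k : ℕ => (r / d) ^ (2 * k)) atTop (𝓝 0) :=
      (tendsto_pow_atTop_nhds_zero_of_lt_one (by positivity) ((div_lt_one hd0).2 hrd)).comp
        (tendsto_id.const_mul_atTop' two_pos)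
    have h4 := ENNReal.Tendsto.mul_const (ENNReal.tendsto_ofReal h3) (Or.inr hC)
    simpa using h4
  exact le_antisymm (ge_of_tendsto' hlim hb) bot_le

/-- A symmetric operator is bounded by the bound of its quadratic form. -/
theorem norm_le_of_quadratic_form_le {V : Type*} [NormedAddCommGroup V] [InnerProductSpace ℂ V]
    {S : V →ₗ[ℂ] V} (hS : S.IsSymmetric) {r : ℝ}
    (h : ∀ x, |(⟪x, S x⟫_ℂ).re| ≤ r * ‖x‖ ^ 2) (x : V) : ‖S x‖ ≤ r * ‖x‖ := by
  by_cases hx : x = 0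
  · simp [hx]
  by_cases hSx : S x = 0
  · have h1 := (abs_nonneg _).trans (h x)
    have h2 : 0 < ‖x‖ := norm_pos_iff.2 hx
    rw [hSx, norm_zero]
    nlinarith
  have hx0 : 0 < ‖x‖ := norm_pos_iff.2 hx
  have hS0 : 0 < ‖S x‖ := norm_pos_iff.2 hSx
  -- Polarization: subtract the form bounds at `x + y` and `x - y`, then use the parallelogram law.
  have hpol : ∀ y, 2 * (⟪S x, y⟫_ℂ).re ≤ r * (‖x‖ ^ 2 + ‖y‖ ^ 2) := by
    intro y
    have e1 : (⟪y, S x⟫_ℂ).re = (⟪S x, y⟫_ℂ).re := by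
      rw [← inner_conj_symm, Complex.conj_re]
    have e2 : (⟪x, S y⟫_ℂ).re = (⟪S x, y⟫_ℂ).re := by rw [hS x y]
    have h1 := (abs_le.1 (h (x + y))).2
    have h2 := (abs_le.1 (h (x - y))).1
    simp only [map_add, map_sub, inner_add_left, inner_add_right, inner_sub_left, inner_sub_right,
      Complex.add_re, Complex.sub_re, e1, e2] at h1 h2
    have h3 : r * (‖x + y‖ ^ 2 + ‖x - y‖ ^ 2) = r * (2 * (‖x‖ ^ 2 + ‖y‖ ^ 2)) := by
      rw [parallelogram_law_with_norm ℂ x y]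
    nlinarith
  -- This `y` is parallel to `S x` and has the norm of `x`, so the left side becomes `2‖x‖‖S x‖` and
  -- the right side `2r‖x‖²`.
  have h4 := hpol (((‖x‖ / ‖S x‖ : ℝ) : ℂ) • S x)
  rw [inner_smul_right, inner_self_eq_norm_sq_to_K, norm_smul, Complex.norm_real, norm_div,
    norm_norm, norm_norm, div_mul_cancel₀ _ hS0.ne'] at h4
  have h5 : ((((‖x‖ / ‖S x‖ : ℝ) : ℂ)) * (‖S x‖ : ℂ) ^ 2).re = ‖x‖ * ‖S x‖ := by
    norm_cast
    field_simp
  change 2 * ((((‖x‖ / ‖S x‖ : ℝ) : ℂ)) * (‖S x‖ : ℂ) ^ 2).re ≤ _ at h4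
  rw [h5] at h4
  nlinarith

variable {H : Type*} [NormedAddCommGroup H] [InnerProductSpace ℂ H] [CompleteSpace H]

namespace ProjectionMeasure

variable (E : ProjectionMeasure H)

theorem inner_proj_left {A : Set ℝ} (hA : MeasurableSet A) (φ ψ : H) :
    ⟪E.proj A φ, ψ⟫_ℂ = ⟪φ, E.proj A ψ⟫_ℂ :=
  (ContinuousLinearMap.isSelfAdjoint_iff_isSymmetric.1 (E.isStarProjection A hA).isSelfAdjoint) φ ψ

theorem proj_proj {A B : Set ℝ} (hA : MeasurableSet A) (hB : MeasurableSet B) (ψ : H) :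
    E.proj A (E.proj B ψ) = E.proj (A ∩ B) ψ := by
  rw [E.inter A B hA hB, mul_apply_eq_comp]

theorem norm_sq_proj {A : Set ℝ} (hA : MeasurableSet A) (ψ : H) :
    ‖E.proj A ψ‖ ^ 2 = (⟪ψ, E.proj A ψ⟫_ℂ).re :=
  norm_sq_apply_of_isStarProjection (E.isStarProjection A hA) ψ

theorem law_apply_norm (ψ : H) {A : Set ℝ} (hA : MeasurableSet A) :
    E.law ψ A = ENNReal.ofReal (‖E.proj A ψ‖ ^ 2) := by
  rw [E.law_apply ψ hA, E.norm_sq_proj hA]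

theorem law_univ (ψ : H) : E.law ψ Set.univ = ENNReal.ofReal (‖ψ‖ ^ 2) := by
  rw [E.law_apply_norm ψ MeasurableSet.univ, E.univ, one_apply_eq_self]

instance (ψ : H) : IsFiniteMeasure (E.law ψ) :=
  ⟨by rw [E.law_univ]; exact ENNReal.ofReal_lt_top⟩

theorem law_proj {B : Set ℝ} (hB : MeasurableSet B) (ψ : H) :
    E.law (E.proj B ψ) = (E.law ψ).restrict B := by
  ext A hA
  rw [Measure.restrict_apply hA, E.law_apply_norm _ hA, E.proj_proj hA hB,
    E.law_apply_norm _ (hA.inter hB)]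

theorem proj_add_proj_compl {B : Set ℝ} (hB : MeasurableSet B) (ψ : H) :
    E.proj B ψ + E.proj Bᶜ ψ = ψ := by
  -- Finite additivity from the countable one: the pair is padded with empty sets.
  have h2 := E.hasSum_iUnion (fun n => if n = 0 then B else if n = 1 then Bᶜ else ∅)
    (fun n => by
      by_cases h0 : n = 0
      · simp [h0, hB]
      · by_cases h1 : n = 1
        · simp [h1, hB]
        · simp [h0, h1])
    (fun i j hij => by
      by_cases hi0 : i = 0 <;> by_cases hi1 : i = 1 <;> by_cases hj0 : j = 0 <;>
        by_cases hj1 : j = 1 <;>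
        simp_all [Function.onFun, disjoint_compl_right, disjoint_compl_left]) ψ
  have h3 : (⋃ n : ℕ, if n = 0 then B else if n = 1 then Bᶜ else ∅) = Set.univ := by
    refine Set.eq_univ_of_forall fun x => Set.mem_iUnion.2 ?_
    by_cases hx : x ∈ B
    · exact ⟨0, by simpa using hx⟩
    · exact ⟨1, by simpa using hx⟩
  rw [h3, E.univ, one_apply_eq_self] at h2
  have h4 := hasSum_sum_of_ne_finset_zero (L := .unconditional ℕ) (s := Finset.range 2)
    (f := fun n => E.proj (if n = 0 then B else if n = 1 then Bᶜ else ∅) ψ) (by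
      intro n hn
      have h0 : n ≠ 0 := by rintro rfl; simp at hn
      have h1 : n ≠ 1 := by rintro rfl; simp at hn
      simp [h0, h1, E.proj_empty])
  have h5 := h4.unique h2
  simpa [Finset.sum_range_succ] using h5

/-- Laws add up over reducing complementary subspaces. -/
theorem law_add_smul {B : Set ℝ} (hB : MeasurableSet B) {φ ψ : H} (hψ : E.proj B ψ = ψ)
    (hφ : E.proj B φ = 0) (c : ℂ) :
    E.law (φ + c • ψ) = E.law φ + ENNReal.ofReal (‖c‖ ^ 2) • E.law ψ := by
  ext A hA
  have horth : ⟪E.proj A φ, E.proj A ψ⟫_ℂ = 0 := by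
    rw [E.inner_proj_left hA, E.proj_proj hA hA, Set.inter_self]
    nth_rewrite 1 [← hψ]
    rw [E.proj_proj hA hB, Set.inter_comm, ← E.proj_proj hB hA, ← E.inner_proj_left hB, hφ,
      inner_zero_left]
  rw [Measure.add_apply, Measure.smul_apply, E.law_apply_norm _ hA, E.law_apply_norm _ hA,
    E.law_apply_norm _ hA, smul_eq_mul, ← ENNReal.ofReal_mul (by positivity),
    ← ENNReal.ofReal_add (by positivity) (by positivity)]
  congr 1
  rw [map_add, map_smul, norm_add_sq (𝕜 := ℂ), inner_smul_right, horth, norm_smul]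
  simp
  ring

theorem integrable_sq_law_of_Icc {c d : ℝ} {ψ : H} (hψ : E.proj (Set.Icc c d) ψ = ψ) :
    Integrable (fun x : ℝ => x ^ 2) (E.law ψ) := by
  rw [← hψ, E.law_proj measurableSet_Icc]
  exact (by fun_prop : Continuous fun x : ℝ => x ^ 2).integrableOn_Icc

/-- The intervals exhaust the line, so the law of `v`, whose total mass is `‖v‖²`, is zero. -/
theorem eq_zero_of_proj_Icc_eq_zero {v : H} (hv : ∀ n : ℕ, E.proj (Set.Icc (-n : ℝ) n) v = 0) :
    v = 0 := by
  have h1 : E.law v (⋃ n : ℕ, Set.Icc (-n : ℝ) n) = 0 :=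
    measure_iUnion_null fun n => by rw [E.law_apply_norm v measurableSet_Icc, hv n]; simp
  have h2 : (⋃ n : ℕ, Set.Icc (-n : ℝ) n) = Set.univ := by
    refine Set.eq_univ_of_forall fun x => Set.mem_iUnion.2 ?_
    obtain ⟨n, hn⟩ := exists_nat_ge |x|
    exact ⟨n, abs_le.1 hn⟩
  rw [h2, E.law_univ, ENNReal.ofReal_eq_zero] at h1
  have h3 : ‖v‖ = 0 := by nlinarith [norm_nonneg v]
  exact norm_eq_zero.1 h3

variable {E} {X : H →ₗ.[ℂ] H}

namespace IsSpectralMeasureOf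

theorem mem_domain_of_Icc (hE : E.IsSpectralMeasureOf X) {c d : ℝ} {ψ : H}
    (hψ : E.proj (Set.Icc c d) ψ = ψ) : ψ ∈ X.domain :=
  (hE.1 ψ).2 (E.integrable_sq_law_of_Icc hψ)

theorem integrable_id (hE : E.IsSpectralMeasureOf X) (ψ : X.domain) :
    Integrable (fun x : ℝ => x) (E.law ψ) := by
  have h1 := (hE.1 ψ).1 ψ.2
  refine Integrable.mono' (h1.add (integrable_const 1)) measurable_id.aestronglyMeasurable
    (Eventually.of_forall fun x => ?_)
  rw [Real.norm_eq_abs, Pi.add_apply, ← sq_abs]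
  nlinarith [sq_nonneg (|x| - 1), abs_nonneg x]

/-- For `|c| = 1` the law of `φ + cψ` is the sum of the two laws, so the cross terms of the
quadratic form cancel. Taking `c = 1` and `c = i` separates them. Symmetry of `X` is not needed. -/
theorem inner_apply_eq_zero (hE : E.IsSpectralMeasureOf X) {B : Set ℝ} (hB : MeasurableSet B)
    {φ ψ : X.domain} (hψ : E.proj B ψ = ψ) (hφ : E.proj B φ = 0) : ⟪(φ : H), X ψ⟫_ℂ = 0 := by
  have hq : ∀ c : ℂ, ‖c‖ = 1 → c * ⟪(φ : H), X ψ⟫_ℂ + conj c * ⟪(ψ : H), X φ⟫_ℂ = 0 := by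
    intro c hc
    have h1 := hE.2 (φ + c • ψ)
    have h2 : E.law ((φ + c • ψ : X.domain) : H) = E.law φ + E.law ψ := by
      have := E.law_add_smul hB hψ hφ c
      rw [hc] at this
      simpa using this
    rw [h2, integral_add_measure (hE.integrable_id φ) (hE.integrable_id ψ)] at h1
    push_cast at h1
    rw [← hE.2 φ, ← hE.2 ψ, X.map_add, X.map_smul] at h1
    simp only [inner_add_left, inner_add_right, inner_smul_left, inner_smul_right] at h1
    have h3 : conj c * c = 1 := by rw [mul_comm, Complex.mul_conj, Complex.normSq_eq_norm_sq, hc]; simp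
    linear_combination h1 - ⟪(ψ : H), X ψ⟫_ℂ * h3
  have h1 := hq 1 (by simp)
  have h2 := hq Complex.I (by simp)
  rw [Complex.conj_I] at h2
  rw [map_one] at h1
  have h3 : Complex.I * (⟪(φ : H), X ψ⟫_ℂ - ⟪(ψ : H), X φ⟫_ℂ) = 0 := by linear_combination h2
  have h4 := (mul_eq_zero.1 h3).resolve_left Complex.I_ne_zero
  linear_combination (1 / 2 : ℂ) * h1 + (1 / 2 : ℂ) * h4

/-- The spectral subspaces are invariant. -/
theorem proj_apply (hE : E.IsSpectralMeasureOf X) {B : Set ℝ} (hB : MeasurableSet B)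
    {ψ : X.domain} (hψ : E.proj B ψ = ψ) : E.proj B (X ψ) = X ψ := by
  -- The part of `X ψ` outside `B` need not lie in the domain. Its truncations to bounded intervals
  -- do, and each is orthogonal to `X ψ`, hence zero.
  have h0 : E.proj Bᶜ (X ψ) = 0 := by
    apply E.eq_zero_of_proj_Icc_eq_zero
    intro n
    have hm : MeasurableSet (Set.Icc (-n : ℝ) n ∩ Bᶜ) := measurableSet_Icc.inter hB.compl
    rw [E.proj_proj measurableSet_Icc hB.compl]
    have hφ : E.proj (Set.Icc (-n : ℝ) n ∩ Bᶜ) (X ψ) ∈ X.domain :=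
      hE.mem_domain_of_Icc (c := -n) (d := n)
        (by rw [E.proj_proj measurableSet_Icc hm, ← Set.inter_assoc, Set.inter_self])
    have h1 : E.proj B (E.proj (Set.Icc (-n : ℝ) n ∩ Bᶜ) (X ψ)) = 0 := by
      rw [E.proj_proj hB hm, Set.inter_left_comm, Set.inter_compl_self, Set.inter_empty,
        E.proj_empty, zero_apply]
    have h2 := hE.inner_apply_eq_zero hB (φ := ⟨_, hφ⟩) hψ h1
    have h3 := E.norm_sq_proj hm (X ψ)
    rw [← E.inner_proj_left hm] at h3
    change ‖_‖ ^ 2 = (⟪E.proj (Set.Icc (-n : ℝ) n ∩ Bᶜ) (X ψ), X ψ⟫_ℂ).re at h3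
    rw [h2] at h3
    simpa using h3
  have h1 := E.proj_add_proj_compl hB (X ψ)
  rwa [h0, add_zero] at h1

section Model

variable {Ω : Type*} [MeasurableSpace Ω] {ν : Measure Ω} {U : H ≃ₗᵢ[ℂ] Lp ℂ 2 ν} {m : Ω → ℝ}

theorem _root_.CEHeis.IsMulOperator.inner_apply_left (hX : IsMulOperator X U m) (φ ψ : X.domain) :
    ⟪X φ, (ψ : H)⟫_ℂ = ⟪(φ : H), X ψ⟫_ℂ := by
  rw [← U.inner_map_map, ← U.inner_map_map (φ : H), L2.inner_def, L2.inner_def]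
  apply integral_congr_ae
  filter_upwards [hX.apply φ, hX.apply ψ] with x h1 h2
  rw [h1, h2]
  simp only [RCLike.inner_apply, map_mul, Complex.conj_ofReal]
  ring

/-- `X - lam` on the spectral subspace of an interval. -/
noncomputable def shiftIcc (hE : E.IsSpectralMeasureOf X) (c d lam : ℝ) :
    LinearMap.eqLocus (E.proj (Set.Icc c d)).toLinearMap LinearMap.id →ₗ[ℂ]
      LinearMap.eqLocus (E.proj (Set.Icc c d)).toLinearMap LinearMap.id where
  toFun ψ := ⟨X ⟨ψ, hE.mem_domain_of_Icc ψ.2⟩ - (lam : ℂ) • (ψ : H), by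
    have h1 := hE.proj_apply measurableSet_Icc (ψ := ⟨ψ, hE.mem_domain_of_Icc ψ.2⟩) ψ.2
    have h2 : E.proj (Set.Icc c d) ψ = ψ := ψ.2
    simp only [LinearMap.mem_eqLocus, ContinuousLinearMap.coe_coe, LinearMap.id_coe, id_eq,
      map_sub, map_smul, h1, h2]⟩
  map_add' φ ψ := by
    apply Subtype.ext
    have : X ⟨(φ : H) + ψ, hE.mem_domain_of_Icc (φ + ψ).2⟩ =
        X ⟨φ, hE.mem_domain_of_Icc φ.2⟩ + X ⟨ψ, hE.mem_domain_of_Icc ψ.2⟩ :=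
      X.map_add ⟨φ, hE.mem_domain_of_Icc φ.2⟩ ⟨ψ, hE.mem_domain_of_Icc ψ.2⟩
    simp only [Submodule.coe_add, this, smul_add]
    abel
  map_smul' k ψ := by
    apply Subtype.ext
    have : X ⟨k • (ψ : H), hE.mem_domain_of_Icc (k • ψ).2⟩ =
        k • X ⟨ψ, hE.mem_domain_of_Icc ψ.2⟩ :=
      X.map_smul k ⟨ψ, hE.mem_domain_of_Icc ψ.2⟩
    simp only [Submodule.coe_smul, this, smul_sub, RingHom.id_apply]
    rw [smul_comm k]

theorem coe_shiftIcc (hE : E.IsSpectralMeasureOf X) (c d lam : ℝ)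
    (ψ : LinearMap.eqLocus (E.proj (Set.Icc c d)).toLinearMap LinearMap.id) :
    (hE.shiftIcc c d lam ψ : H) = X ⟨ψ, hE.mem_domain_of_Icc ψ.2⟩ - (lam : ℂ) • (ψ : H) := rfl

/-- The law of a vector in this subspace lives on the interval, where `|x - lam| ≤ r`; this bounds
the quadratic form. Symmetry, which comes from the real multiplier `m`, upgrades it to a norm bound.
-/
theorem norm_shiftIcc_le (hE : E.IsSpectralMeasureOf X) (hX : IsMulOperator X U m) {lam r : ℝ}
    (ψ : LinearMap.eqLocus (E.proj (Set.Icc (lam - r) (lam + r))).toLinearMap LinearMap.id) :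
    ‖hE.shiftIcc (lam - r) (lam + r) lam ψ‖ ≤ r * ‖ψ‖ := by
  apply norm_le_of_quadratic_form_le
  · intro φ ψ
    simp only [Submodule.coe_inner, coe_shiftIcc, inner_sub_left, inner_sub_right,
      inner_smul_left, inner_smul_right, Complex.conj_ofReal]
    rw [hX.inner_apply_left ⟨φ, hE.mem_domain_of_Icc φ.2⟩ ⟨ψ, hE.mem_domain_of_Icc ψ.2⟩]
  · intro φ
    have hφ : E.proj (Set.Icc (lam - r) (lam + r)) φ = φ := φ.2
    have h1 := hE.2 ⟨φ, hE.mem_domain_of_Icc φ.2⟩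
    have hmass : (E.law (φ : H)).real Set.univ = ‖φ‖ ^ 2 := by
      rw [Measure.real, E.law_univ, ENNReal.toReal_ofReal (by positivity)]
      rfl
    simp only [Submodule.coe_inner, coe_shiftIcc, inner_sub_right, inner_smul_right]
    rw [h1, inner_self_eq_norm_sq_to_K, ← hmass]
    have h2 : (((∫ x, x ∂(E.law (φ : H)) : ℝ) : ℂ) - (lam : ℂ) * ((‖(φ : H)‖ : ℂ)) ^ 2).re =
        ∫ x, (x - lam) ∂(E.law (φ : H)) := by
      rw [integral_sub (hE.integrable_id ⟨φ, hE.mem_domain_of_Icc φ.2⟩) (integrable_const _),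
        integral_const, hmass]
      norm_cast
      rw [smul_eq_mul, mul_comm]
    change |(((∫ x, x ∂(E.law (φ : H)) : ℝ) : ℂ) - (lam : ℂ) * ((‖(φ : H)‖ : ℂ)) ^ 2).re| ≤ _
    rw [h2]
    refine norm_integral_le_of_norm_le_const (f := fun x => x - lam) ?_
    rw [← hφ, E.law_proj measurableSet_Icc]
    filter_upwards [ae_restrict_mem measurableSet_Icc] with x hx
    rw [Real.norm_eq_abs, abs_le]
    constructor <;> linarith [hx.1, hx.2]

/-- Invariance of the spectral subspace keeps all iterates in the domain, so the action of `X` in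
the model can be applied repeatedly. This links an arbitrary `E` to the multiplier `m`. -/
theorem coeFn_shiftIcc_pow (hE : E.IsSpectralMeasureOf X) (hX : IsMulOperator X U m) (c d lam : ℝ)
    (k : ℕ) (ψ : LinearMap.eqLocus (E.proj (Set.Icc c d)).toLinearMap LinearMap.id) :
    U ((hE.shiftIcc c d lam ^ k) ψ : H) =ᵐ[ν] fun x => ((m x - lam : ℝ) : ℂ) ^ k * U ψ x := by
  induction k with
  | zero => simp
  | succ k ih =>
    rw [pow_succ', Module.End.mul_apply, coe_shiftIcc, map_sub, map_smul]
    set χ := (hE.shiftIcc c d lam ^ k) ψ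
    filter_upwards [ih, hX.apply ⟨χ, hE.mem_domain_of_Icc χ.2⟩,
      Lp.coeFn_sub (U (X ⟨χ, hE.mem_domain_of_Icc χ.2⟩)) ((lam : ℂ) • U χ),
      Lp.coeFn_smul (lam : ℂ) (U χ)] with x h1 h2 h3 h4
    rw [h3, Pi.sub_apply, h2, h4, Pi.smul_apply]
    simp only [h1, smul_eq_mul]
    push_cast
    ring

/-- The moment of order `2k` about `lam` in the model is `‖(X - lam)ᵏ ψ‖²`, at most `r^(2k) ‖ψ‖²`;
such growth confines the measure to the interval. -/
theorem sqMeasure_compl_eq_zero (hE : E.IsSpectralMeasureOf X) (hX : IsMulOperator X U m)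
    (hm : Measurable m) {lam r : ℝ} (hr : 0 ≤ r)
    {ψ : H} (hψ : E.proj (Set.Icc (lam - r) (lam + r)) ψ = ψ) :
    ((sqMeasure (U ψ)).map m) {x | r < |x - lam|} = 0 := by
  have : IsFiniteMeasure ((sqMeasure (U ψ)).map m) := Measure.isFiniteMeasure_map _ _
  refine measure_abs_gt_eq_zero hr (C := ENNReal.ofReal (‖ψ‖ ^ 2)) ENNReal.ofReal_ne_top fun k => ?_
  set S := hE.shiftIcc (lam - r) (lam + r) lam
  have hb : ∀ k : ℕ, ‖(S ^ k) ⟨ψ, hψ⟩‖ ≤ r ^ k * ‖ψ‖ := by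
    intro k
    induction k with
    | zero => simp
    | succ k ih =>
      rw [pow_succ', Module.End.mul_apply]
      calc ‖S ((S ^ k) ⟨ψ, hψ⟩)‖ ≤ r * ‖(S ^ k) ⟨ψ, hψ⟩‖ := hE.norm_shiftIcc_le hX _
        _ ≤ r * (r ^ k * ‖ψ‖) := by gcongr
        _ = _ := by ring
  set χ := (S ^ k) ⟨ψ, hψ⟩
  have h1 : sqMeasure (U χ) Set.univ = ENNReal.ofReal (‖χ‖ ^ 2) := by
    have := (mulProjectionMeasure U hm).law_univ χ
    rwa [mulProjectionMeasure_law, Measure.map_apply hm MeasurableSet.univ] at this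
  calc ∫⁻ x, ENNReal.ofReal (|x - lam| ^ (2 * k)) ∂((sqMeasure (U ψ)).map m)
      = ∫⁻ x, ((‖U ψ x‖₊ ^ 2 : ℝ≥0) : ℝ≥0∞) * ENNReal.ofReal (|m x - lam| ^ (2 * k)) ∂ν := by
        rw [lintegral_map (by fun_prop) hm, sqMeasure, lintegral_withDensity_eq_lintegral_mul _
          (measurable_nnnorm_sq _).coe_nnreal_ennreal (by fun_prop)]
        rfl
    _ = ∫⁻ x, ((‖U χ x‖₊ ^ 2 : ℝ≥0) : ℝ≥0∞) ∂ν := by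
        apply lintegral_congr_ae
        filter_upwards [hE.coeFn_shiftIcc_pow hX (lam - r) (lam + r) lam k ⟨ψ, hψ⟩] with x hx
        rw [hx, nnnorm_mul, mul_pow, mul_comm, nnnorm_pow, ENNReal.coe_mul]
        congr 1
        rw [← pow_mul, mul_comm k 2, ENNReal.ofReal_pow (abs_nonneg _), ENNReal.coe_pow]
        congr 1
        rw [← Real.norm_eq_abs, ofReal_norm, enorm_eq_nnnorm, Complex.nnnorm_real]
    _ = ENNReal.ofReal (‖χ‖ ^ 2) := by
        rw [← h1, sqMeasure, withDensity_apply _ MeasurableSet.univ, Measure.restrict_univ]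
    _ ≤ ENNReal.ofReal (r ^ (2 * k)) * ENNReal.ofReal (‖ψ‖ ^ 2) := by
        rw [← ENNReal.ofReal_mul (by positivity)]
        apply ENNReal.ofReal_le_ofReal
        calc ‖χ‖ ^ 2 ≤ (r ^ k * ‖ψ‖) ^ 2 := by
              gcongr
              exact hb k
          _ = _ := by ring

/-- The law of a state under any spectral measure of a multiplication operator. -/
theorem law_eq (hE : E.IsSpectralMeasureOf X) (hX : IsMulOperator X U m) (hm : Measurable m)
    (ψ : H) : E.law ψ = (sqMeasure (U ψ)).map m := by
  rw [← mulProjectionMeasure_law U hm]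
  set F := mulProjectionMeasure U hm with hF
  apply measure_eq_of_Icc_le
  · intro c d
    by_cases hcd : c ≤ d
    swap
    · simp [Set.Icc_eq_empty hcd]
    have hI : Set.Icc c d = Set.Icc ((c + d) / 2 - (d - c) / 2) ((c + d) / 2 + (d - c) / 2) := by
      congr 1 <;> ring
    have hJ : MeasurableSet (Set.Icc c d) := measurableSet_Icc
    -- The range of `E` of the interval lies inside the range of `F` of the same interval.
    have hFE : ∀ φ, F.proj (Set.Icc c d) (E.proj (Set.Icc c d) φ) = E.proj (Set.Icc c d) φ := by
      intro φ
      have h1 : E.proj (Set.Icc c d) (E.proj (Set.Icc c d) φ) = E.proj (Set.Icc c d) φ := by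
        rw [E.proj_proj hJ hJ, Set.inter_self]
      have h2 := hE.sqMeasure_compl_eq_zero hX hm (lam := (c + d) / 2) (r := (d - c) / 2)
        (by linarith) (ψ := E.proj (Set.Icc c d) φ) (by rw [← hI]; exact h1)
      rw [← mulProjectionMeasure_law U hm, ← hF] at h2
      have h3 : {x : ℝ | (d - c) / 2 < |x - (c + d) / 2|} = (Set.Icc c d)ᶜ := by
        ext x
        rw [hI, Set.mem_compl_iff, Set.mem_Icc, Set.mem_ofPred_eq, ← not_le, abs_le]
        apply not_congr
        constructor <;> rintro ⟨h4, h5⟩ <;> constructor <;> linarith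
      rw [h3, F.law_apply_norm _ hJ.compl, ENNReal.ofReal_eq_zero] at h2
      have h4 : F.proj (Set.Icc c d)ᶜ (E.proj (Set.Icc c d) φ) = 0 := by
        rw [← norm_eq_zero]
        nlinarith [norm_nonneg (F.proj (Set.Icc c d)ᶜ (E.proj (Set.Icc c d) φ))]
      have h5 := F.proj_add_proj_compl hJ (E.proj (Set.Icc c d) φ)
      rwa [h4, add_zero] at h5
    rw [E.law_apply_norm _ hJ, F.law_apply_norm _ hJ]
    apply ENNReal.ofReal_le_ofReal
    -- By the inclusion of ranges `‖Eψ‖² = ⟪Fψ, Eψ⟫`, and Cauchy–Schwarz applies.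
    have h6 : ‖E.proj (Set.Icc c d) ψ‖ ^ 2 ≤ ‖F.proj (Set.Icc c d) ψ‖ * ‖E.proj (Set.Icc c d) ψ‖ := by
      have h7 : ⟪E.proj (Set.Icc c d) ψ, E.proj (Set.Icc c d) ψ⟫_ℂ =
          ⟪F.proj (Set.Icc c d) ψ, E.proj (Set.Icc c d) ψ⟫_ℂ := by
        rw [F.inner_proj_left hJ, hFE, E.inner_proj_left hJ, E.proj_proj hJ hJ, Set.inter_self]
      have h8 := norm_inner_le_norm (𝕜 := ℂ) (F.proj (Set.Icc c d) ψ) (E.proj (Set.Icc c d) ψ)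
      rw [← h7, inner_self_eq_norm_sq_to_K] at h8
      simpa using h8
    have h9 : ‖E.proj (Set.Icc c d) ψ‖ ≤ ‖F.proj (Set.Icc c d) ψ‖ := by
      by_contra! hlt
      nlinarith [norm_nonneg (F.proj (Set.Icc c d) ψ)]
    gcongr
  · rw [E.law_univ, F.law_univ]

end Model

end IsSpectralMeasureOf

end ProjectionMeasure

end Uniqueness

end CEHeis

namespace CEHeis

open Filter Topology ENNReal NNReal

/-! ### Recognizing the closure of a symmetric operator as a multiplication operator -/

section Closure

variable {H : Type*} [NormedAddCommGroup H] [InnerProductSpace ℂ H] [CompleteSpace H]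
  {Ω : Type*} [MeasurableSpace Ω] {ν : Measure Ω} {U : H ≃ₗᵢ[ℂ] Lp ℂ 2 ν} {m : Ω → ℝ}

/-- The inner product is real, so the cross term is purely imaginary. Used to show that `X + i` is
injective for symmetric `X`. -/
theorem norm_add_I_smul_sq {φ ψ : H} (hs : ⟪ψ, φ⟫_ℂ = ⟪φ, ψ⟫_ℂ) :
    ‖φ + Complex.I • ψ‖ ^ 2 = ‖φ‖ ^ 2 + ‖ψ‖ ^ 2 := by
  have h0 : (⟪φ, ψ⟫_ℂ).im = 0 := by
    have h1 := congrArg Complex.im hs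
    rw [← inner_conj_symm, Complex.conj_im] at h1
    linarith
  rw [norm_add_sq (𝕜 := ℂ), inner_smul_right, norm_smul, Complex.norm_I, one_mul]
  simp [h0]

/-- Density of the range of `T + i` alone suffices; no condition at `-i` is needed, because the
candidate `m` is real and `m + i` is invertible with `|m + i| ≥ 1`. Approximating `χ + iψ` by `(T +
i)f` then forces `f → ψ` and `T f → χ`, so the maximal multiplication operator lies in the closure.
Conversely `X + i` is injective by symmetry and already surjective on that smaller operator, so the
two coincide. -/
theorem isMulOperator_closure {D : Submodule ℂ H} {T : D →ₗ[ℂ] H} (hD : Dense (D : Set H))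
    (hT : ∀ φ ψ : D, ⟪T φ, (ψ : H)⟫_ℂ = ⟪(φ : H), T ψ⟫_ℂ) (hm : Measurable m)
    {ι : Type*} (e : ι → D) (he : ∀ i, U (T (e i)) =ᵐ[ν] fun x => (m x : ℂ) * U (e i) x)
    (hdense : (Submodule.span ℂ (Set.range fun i => T (e i) + Complex.I • (e i : H))).topologicalClosure
      = ⊤) :
    IsMulOperator (LinearPMap.closure ⟨D, T⟩) U m := by
  -- A densely defined symmetric operator is contained in its adjoint, which is closed.
  have hclosable : LinearPMap.IsClosable (⟨D, T⟩ : H →ₗ.[ℂ] H) := by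
    have h1 : LinearPMap.IsFormalAdjoint (⟨D, T⟩ : H →ₗ.[ℂ] H) ⟨D, T⟩ := fun x y => hT x y
    exact (LinearPMap.adjoint_isClosed hD).isClosable.leIsClosable (h1.le_adjoint hD)
  set X := LinearPMap.closure (⟨D, T⟩ : H →ₗ.[ℂ] H) with hX
  have hgraph : X.graph = (LinearPMap.graph (⟨D, T⟩ : H →ₗ.[ℂ] H)).topologicalClosure :=
    hclosable.graph_closure_eq_closure_graph.symm
  have hmC : Measurable fun x => (m x : ℂ) := Complex.measurable_ofReal.comp hm
  have hsym : ∀ ψ : X.domain, ⟪(ψ : H), X ψ⟫_ℂ = ⟪X ψ, (ψ : H)⟫_ℂ := by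
    intro ψ
    have h1 : ((ψ : H), X ψ) ∈ X.graph := X.mem_graph ψ
    have h2 : IsClosed {p : H × H | ⟪p.1, p.2⟫_ℂ = ⟪p.2, p.1⟫_ℂ} :=
      isClosed_eq (by fun_prop) (by fun_prop)
    have h3 : closure ((LinearPMap.graph (⟨D, T⟩ : H →ₗ.[ℂ] H) : Submodule ℂ (H × H)) : Set (H × H)) ⊆
        {p : H × H | ⟪p.1, p.2⟫_ℂ = ⟪p.2, p.1⟫_ℂ} := by
      refine closure_minimal ?_ h2
      intro p hp
      obtain ⟨y, hy1, hy2⟩ := (LinearPMap.mem_graph_iff _).1 hp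
      rw [Set.mem_ofPred_eq, ← hy1, ← hy2]
      exact (hT y y).symm
    rw [hgraph] at h1
    exact h3 h1
  have hgood : ∀ f ∈ Submodule.span ℂ (Set.range e), U (T f) =ᵐ[ν] fun x => (m x : ℂ) * U f x := by
    intro f hf
    induction hf using Submodule.span_induction with
    | mem f hf => obtain ⟨i, rfl⟩ := hf; exact he i
    | zero =>
      simp only [map_zero, Submodule.coe_zero]
      filter_upwards [Lp.coeFn_zero ℂ 2 ν] with x hx
      rw [hx]
      simp
    | add f g _ _ hf hg =>
      rw [map_add, map_add, Submodule.coe_add, map_add]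
      filter_upwards [hf, hg, Lp.coeFn_add (U (T f)) (U (T g)), Lp.coeFn_add (U f) (U g)]
        with x h1 h2 h3 h4
      rw [h3, h4, Pi.add_apply, Pi.add_apply, h1, h2]
      ring
    | smul c f _ hf =>
      rw [map_smul, map_smul, Submodule.coe_smul, map_smul]
      filter_upwards [hf, Lp.coeFn_smul c (U (T f)), Lp.coeFn_smul c (U f)] with x h1 h3 h4
      rw [h3, h4, Pi.smul_apply, Pi.smul_apply, h1, smul_eq_mul, smul_eq_mul]
      ring
  have hback : ∀ ψ χ : H, U χ =ᵐ[ν] (fun x => (m x : ℂ) * U ψ x) → (ψ, χ) ∈ X.graph := by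
    intro ψ χ hχ
    have hη : χ + Complex.I • ψ ∈ closure
        ((Submodule.span ℂ (Set.range fun i => T (e i) + Complex.I • (e i : H)) : Submodule ℂ H) :
          Set H) := by
      rw [← Submodule.topologicalClosure_coe, hdense]
      trivial
    obtain ⟨u, hu, hlim⟩ := mem_closure_iff_seq_limit.1 hη
    have hspan : Submodule.span ℂ (Set.range fun i => T (e i) + Complex.I • (e i : H)) =
        (Submodule.span ℂ (Set.range e)).map (T + Complex.I • D.subtype) := by
      rw [Submodule.map_span, ← Set.range_comp]
      rfl
    have hu2 : ∀ k, ∃ f ∈ Submodule.span ℂ (Set.range e), T f + Complex.I • (f : H) = u k := by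
      intro k
      have := hu k
      rw [SetLike.mem_coe, hspan, Submodule.mem_map] at this
      exact this
    choose f hf hfu using hu2
    have hf0 : ∀ k, ‖(f k : H) - ψ‖ ≤ ‖u k - (χ + Complex.I • ψ)‖ := by
      intro k
      rw [← U.norm_map, ← U.norm_map (u k - _), ← hfu k]
      apply Lp.norm_le_norm_of_ae_le
      simp only [map_sub, map_add, map_smul]
      filter_upwards [hχ, hgood _ (hf k), Lp.coeFn_sub (U (f k)) (U ψ),
        Lp.coeFn_sub (U (T (f k)) + Complex.I • U (f k)) (U χ + Complex.I • U ψ),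
        Lp.coeFn_add (U (T (f k))) (Complex.I • U (f k)), Lp.coeFn_add (U χ) (Complex.I • U ψ),
        Lp.coeFn_smul Complex.I (U (f k)), Lp.coeFn_smul Complex.I (U ψ)]
        with x h1 h2 h3 h4 h5 h6 h7 h8
      rw [h3, h4, Pi.sub_apply, Pi.sub_apply, h5, h6, Pi.add_apply, Pi.add_apply, h7, h8,
        Pi.smul_apply, Pi.smul_apply, h1, h2, smul_eq_mul, smul_eq_mul,
        show (m x : ℂ) * U (f k) x + Complex.I * U (f k) x - ((m x : ℂ) * U ψ x + Complex.I * U ψ x)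
          = ((m x : ℂ) + Complex.I) * (U (f k) x - U ψ x) by ring, norm_mul]
      refine le_mul_of_one_le_left (norm_nonneg _) ?_
      have := Complex.abs_im_le_norm ((m x : ℂ) + Complex.I)
      simpa using this
    have hlim1 : Tendsto (fun k => (f k : H)) atTop (𝓝 ψ) := by
      rw [tendsto_iff_norm_sub_tendsto_zero]
      exact squeeze_zero (fun _ => norm_nonneg _) hf0 (tendsto_iff_norm_sub_tendsto_zero.1 hlim)
    have hlim2 : Tendsto (fun k => T (f k)) atTop (𝓝 χ) := by
      have := hlim.sub (hlim1.const_smul Complex.I)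
      simpa [← hfu] using this
    rw [hgraph, ← SetLike.mem_coe, Submodule.topologicalClosure_coe]
    refine mem_closure_of_tendsto (hlim1.prodMk_nhds hlim2) (Eventually.of_forall fun k => ?_)
    exact LinearPMap.mem_graph (⟨D, T⟩ : H →ₗ.[ℂ] H) (f k)
  have hfwd : ∀ ψ : X.domain, U (X ψ) =ᵐ[ν] fun x => (m x : ℂ) * U ψ x := by
    intro ψ
    have hne : ∀ x, 1 ≤ ‖(m x : ℂ) + Complex.I‖ := by
      intro x
      have := Complex.abs_im_le_norm ((m x : ℂ) + Complex.I)
      simpa using this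
    -- Solve `(m + i) Uψ' = Uη` in the model; `ψ'` lies in the domain by `hback`, and injectivity of
    -- `X + i` identifies it with `ψ`.
    set η := X ψ + Complex.I • (ψ : H) with hη
    have hf : MemLp (fun x => ((m x : ℂ) + Complex.I)⁻¹ * U η x) 2 ν := by
      refine (Lp.memLp (U η)).mono
        ((hmC.add_const _).inv.aestronglyMeasurable.mul (Lp.aestronglyMeasurable _))
        (Eventually.of_forall fun x => ?_)
      rw [norm_mul, norm_inv]
      exact mul_le_of_le_one_left (norm_nonneg _) (inv_le_one_of_one_le₀ (hne x))
    have hmf : MemLp (fun x => (m x : ℂ) * (((m x : ℂ) + Complex.I)⁻¹ * U η x)) 2 ν := by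
      refine (Lp.memLp (U η)).mono (hmC.aestronglyMeasurable.mul hf.1)
        (Eventually.of_forall fun x => ?_)
      rw [norm_mul, norm_mul, norm_inv, ← mul_assoc]
      refine mul_le_of_le_one_left (norm_nonneg _) ?_
      rw [← div_eq_mul_inv, div_le_one (by linarith [hne x])]
      have := Complex.abs_re_le_norm ((m x : ℂ) + Complex.I)
      simpa using this
    have hU1 : U (U.symm hf.toLp) =ᵐ[ν] fun x => ((m x : ℂ) + Complex.I)⁻¹ * U η x := by
      rw [LinearIsometryEquiv.apply_symm_apply]
      exact hf.coeFn_toLp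
    have hU2 : U (U.symm hmf.toLp) =ᵐ[ν] fun x => (m x : ℂ) * U (U.symm hf.toLp) x := by
      rw [LinearIsometryEquiv.apply_symm_apply]
      filter_upwards [hmf.coeFn_toLp, hU1] with x h1 h2
      rw [h1, h2]
    obtain ⟨ψ', h1, h2⟩ := (LinearPMap.mem_graph_iff _).1 (hback _ _ hU2)
    simp only at h1 h2
    rw [← h1, ← h2] at hU2
    have hη' : X ψ' + Complex.I • (ψ' : H) = η := by
      apply U.injective
      apply Lp.ext
      rw [map_add, map_smul]
      rw [← h1] at hU1
      filter_upwards [hU1, hU2, Lp.coeFn_add (U (X ψ')) (Complex.I • U ψ'),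
        Lp.coeFn_smul Complex.I (U ψ')] with x h3 h4 h5 h6
      rw [h5, Pi.add_apply, h6, Pi.smul_apply, h4, h3, smul_eq_mul]
      have : (m x : ℂ) + Complex.I ≠ 0 := norm_pos_iff.1 (by linarith [hne x])
      field_simp
    have hdiff : ‖X (ψ' - ψ) + Complex.I • ((ψ' - ψ : X.domain) : H)‖ = 0 := by
      rw [norm_eq_zero, X.map_sub, Submodule.coe_sub, smul_sub]
      rw [hη] at hη'
      rw [sub_add_sub_comm, hη', sub_self]
    have h7 := norm_add_I_smul_sq (hsym (ψ' - ψ))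
    rw [hdiff] at h7
    have h8 : ‖((ψ' - ψ : X.domain) : H)‖ = 0 := by
      nlinarith [sq_nonneg ‖X (ψ' - ψ)‖, sq_nonneg ‖((ψ' - ψ : X.domain) : H)‖]
    have h9 : ψ' = ψ := by
      rw [norm_eq_zero, Submodule.coe_eq_zero] at h8
      exact sub_eq_zero.1 h8
    rwa [h9] at hU2
  refine ⟨fun ψ => ⟨fun hψ => ?_, fun hψ => ?_⟩, hfwd⟩
  · exact (memLp_congr_ae (hfwd ⟨ψ, hψ⟩)).1 (Lp.memLp _)
  · have : U (U.symm hψ.toLp) =ᵐ[ν] fun x => (m x : ℂ) * U ψ x := by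
      rw [LinearIsometryEquiv.apply_symm_apply]
      exact hψ.coeFn_toLp
    obtain ⟨ψ', h1, -⟩ := (LinearPMap.mem_graph_iff _).1 (hback _ _ this)
    simp only at h1
    rw [← h1]
    exact ψ'.2

end Closure

end CEHeis

namespace CEHeis

open Filter Topology

/-! ### Quadratic operators in the number basis -/

section Fock

theorem rapid_single (n k : ℕ) :
    Summable fun i : ℕ => (i : ℝ) ^ k * ‖(Pi.single n (1 : ℂ) : ℕ → ℂ) i‖ ^ 2 := by
  apply summable_of_ne_finset_zero (s := {n})
  intro i hi
  have : i ≠ n := by simpa using hi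
  simp [this]

/-- The number vectors. -/
noncomputable def numVec (n : ℕ) : smooth := mkSmooth (Pi.single n 1) (rapid_single n)

theorem numVec_apply (n i : ℕ) : (numVec n : Fock) i = if i = n then 1 else 0 := by
  change (Pi.single n (1 : ℂ) : ℕ → ℂ) i = _
  rw [Pi.single_apply]

theorem coe_numVec (n : ℕ) : (numVec n : Fock) = lp.single 2 n (1 : ℂ) := by
  apply lp.ext
  funext i
  rw [numVec_apply, lp.single_apply, Pi.single_apply]

theorem inner_numVec (n : ℕ) (g : Fock) : ⟪(numVec n : Fock), g⟫_ℂ = g n := by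
  rw [coe_numVec, lp.inner_single_left]
  simp

theorem vacuum_eq : vacuum = numVec 0 := by
  apply lp.ext
  funext i
  rw [vacuum, expVec_apply, numVec_apply]
  cases i <;> simp

/-- At `n = 0` the truncated index `n - 1` is harmless, since the factor `√0` vanishes. -/
theorem b_numVec (n : ℕ) : b (numVec n) = (√(n : ℝ) : ℂ) • numVec (n - 1) := by
  apply Subtype.ext
  apply lp.ext
  funext i
  change (b (numVec n) : Fock) i = (√(n : ℝ) : ℂ) * (numVec (n - 1) : Fock) i
  rw [b_apply, numVec_apply, numVec_apply]
  rcases n with _ | n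
  · simp
  · by_cases h : i = n <;> simp [h]

theorem bdag_numVec (n : ℕ) : bdag (numVec n) = (√((n : ℝ) + 1) : ℂ) • numVec (n + 1) := by
  apply Subtype.ext
  apply lp.ext
  funext i
  change (bdag (numVec n) : Fock) i = (√((n : ℝ) + 1) : ℂ) * (numVec (n + 1) : Fock) i
  rw [bdag_apply, numVec_apply, numVec_apply]
  rcases i with _ | i
  · simp
  · by_cases h : i = n <;> simp [h]

theorem inner_b (f g : smooth) : ⟪(b f : Fock), (g : Fock)⟫_ℂ = ⟪(f : Fock), (bdag g : Fock)⟫_ℂ := by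
  rw [← inner_conj_symm, ← inner_bdag, inner_conj_symm]

/-- The quadratic operator `l (b - b†)² + k b + k̄ b†`. -/
noncomputable def quadOp (l : ℝ) (k : ℂ) : Module.End ℂ smooth :=
  (l : ℂ) • (b - bdag) ^ 2 + k • b + conj k • bdag

theorem quadOp_apply (l : ℝ) (k : ℂ) (f : smooth) :
    quadOp l k f = (l : ℂ) • (b (b f) - b (bdag f) - bdag (b f) + bdag (bdag f)) + k • b f
      + conj k • bdag f := by
  simp only [quadOp, LinearMap.add_apply, LinearMap.smul_apply, pow_two, Module.End.mul_apply,
    LinearMap.sub_apply, map_sub]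
  congr 3
  abel

theorem inner_quadOp (l : ℝ) (k : ℂ) (f g : smooth) :
    ⟪(quadOp l k f : Fock), (g : Fock)⟫_ℂ = ⟪(f : Fock), (quadOp l k g : Fock)⟫_ℂ := by
  simp only [quadOp_apply, Submodule.coe_add, Submodule.coe_sub, Submodule.coe_smul,
    inner_add_left, inner_add_right, inner_sub_left, inner_sub_right, inner_smul_left,
    inner_smul_right, inner_b, inner_bdag, Complex.conj_ofReal, Complex.conj_conj]
  ring

/-- The row of the matrix of `quadOp` in the number basis. -/
theorem inner_quadOp_numVec (l : ℝ) (k : ℂ) (n : ℕ) (g : Fock) :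
    ⟪(quadOp l k (numVec n) : Fock), g⟫_ℂ =
      l * (√(n : ℝ) * √((n - 1 : ℕ) : ℝ) * g (n - 2) - (2 * n + 1) * g n
        + √((n : ℝ) + 1) * √((n : ℝ) + 2) * g (n + 2))
      + conj k * (√(n : ℝ) * g (n - 1)) + k * (√((n : ℝ) + 1) * g (n + 1)) := by
  have e1 : ∀ t : ℝ, 0 ≤ t → (√t : ℂ) * (√t : ℂ) = t := by
    intro t ht
    rw [← Complex.ofReal_mul, Real.mul_self_sqrt ht]
  have h1 : b (bdag (numVec n)) = ((n : ℂ) + 1) • numVec n := by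
    rw [bdag_numVec, map_smul, b_numVec, smul_smul]
    congr 1
    push_cast
    rw [e1 _ (by positivity)]
    push_cast
    rfl
  have h2 : bdag (b (numVec n)) = (n : ℂ) • numVec n := by
    rw [b_numVec, map_smul, bdag_numVec, smul_smul]
    rcases n with _ | n
    · simp
    · rw [Nat.add_sub_cancel]
      congr 1
      push_cast
      rw [e1 _ (by positivity)]
      push_cast
      rfl
  have h3 : bdag (bdag (numVec n)) = ((√((n : ℝ) + 1) : ℂ) * (√((n : ℝ) + 2) : ℂ)) • numVec (n + 2) := by
    rw [bdag_numVec, map_smul, bdag_numVec, smul_smul]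
    congr 3
    push_cast
    ring_nf
  rw [quadOp_apply, h1, h2, h3, b_numVec, map_smul, b_numVec, bdag_numVec]
  simp only [Submodule.coe_add, Submodule.coe_sub, Submodule.coe_smul, inner_add_left,
    inner_sub_left, inner_smul_left, inner_numVec, Complex.conj_ofReal, Complex.conj_conj, map_mul,
    map_add, map_one, Complex.conj_natCast, Nat.sub_sub, Nat.reduceAdd]
  ring

/-- Arithmetic–geometric mean with the factor one half given away. -/
theorem norm_mul_le_half_sq (c x y : ℂ) : ‖c * (conj x * y)‖ ≤ ‖c‖ * (‖x‖ ^ 2 + ‖y‖ ^ 2) := by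
  rw [norm_mul, norm_mul, RCLike.norm_conj]
  gcongr
  nlinarith [sq_nonneg (‖x‖ - ‖y‖), sq_nonneg ‖x‖, sq_nonneg ‖y‖]

/-- The flux identity behind essential self-adjointness: a deficiency vector satisfies a discrete
conservation law. -/
theorem sum_norm_sq_eq_flux {l : ℝ} {k : ℂ} {g : ℕ → ℂ}
    (hg : ∀ n : ℕ, l * (√(n : ℝ) * √((n - 1 : ℕ) : ℝ) * g (n - 2) - (2 * n + 1) * g n
        + √((n : ℝ) + 1) * √((n : ℝ) + 2) * g (n + 2))
      + conj k * (√(n : ℝ) * g (n - 1)) + k * (√((n : ℝ) + 1) * g (n + 1)) = Complex.I * g n)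
    (K : ℕ) :
    ∑ n ∈ Finset.range (K + 2), ‖g n‖ ^ 2 =
      l * ((((√((K : ℝ) + 2) * √((K : ℝ) + 3) : ℝ) : ℂ) * (conj (g (K + 1)) * g (K + 3))).im
        + (((√((K : ℝ) + 1) * √((K : ℝ) + 2) : ℝ) : ℂ) * (conj (g K) * g (K + 2))).im)
      + ((k * √((K : ℝ) + 2)) * (conj (g (K + 1)) * g (K + 2))).im := by
  -- Multiply the recurrence by `conj (g n)` and take imaginary parts: the diagonal term is real and
  -- disappears.
  have hg' : ∀ n : ℕ, ‖g n‖ ^ 2 =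
      l * (√(n : ℝ) * √((n - 1 : ℕ) : ℝ) * (conj (g n) * g (n - 2)).im
        + √((n : ℝ) + 1) * √((n : ℝ) + 2) * (conj (g n) * g (n + 2)).im)
      + √(n : ℝ) * (conj k * (conj (g n) * g (n - 1))).im
      + √((n : ℝ) + 1) * (k * (conj (g n) * g (n + 1))).im := by
    intro n
    have h1 := congrArg (fun w => (conj (g n) * w).im) (hg n)
    have h2 : (conj (g n) * (Complex.I * g n)).im = ‖g n‖ ^ 2 := by
      rw [← Complex.normSq_eq_norm_sq, Complex.normSq_apply]
      simp
    rw [h2] at h1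
    rw [← h1]
    simp only [Complex.mul_im, Complex.mul_re, Complex.add_im, Complex.add_re, Complex.sub_im,
      Complex.sub_re, Complex.ofReal_re, Complex.ofReal_im, Complex.conj_re, Complex.conj_im,
      Complex.natCast_re, Complex.natCast_im, Complex.one_re, Complex.one_im,
      Complex.re_ofNat, Complex.im_ofNat]
    ring
  induction K with
  | zero =>
    rw [Finset.sum_range_succ, Finset.sum_range_one, hg' 0, hg' 1]
    norm_num
    ring
  -- In row `K + 2` the terms with `g K` and `g (K + 1)` cancel the flux entering that row, by
  -- antisymmetry of `Im (ū v)`; the terms with larger indices form the new flux.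
  | succ K ih =>
    rw [Finset.sum_range_succ, ih, hg' (K + 2)]
    push_cast
    simp only [show K + 1 + 2 = K + 3 from rfl, show K + 2 + 2 = K + 4 from rfl,
      show K + 1 + 1 = K + 2 from rfl]
    rw [show (K : ℝ) + 2 + 1 = K + 3 by ring, show (K : ℝ) + 2 + 2 = K + 4 by ring,
      show (K : ℝ) + 1 + 2 = K + 3 by ring, show (K : ℝ) + 1 + 3 = K + 4 by ring,
      show (K : ℝ) + 1 + 1 = K + 2 by ring]
    simp only [Complex.mul_im, Complex.mul_re, Complex.ofReal_re, Complex.ofReal_im,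
      Complex.conj_re, Complex.conj_im]
    ring

/-- A nonnegative sequence whose partial sums are bounded by `n` times a summable sequence
vanishes. -/
theorem eq_zero_of_sum_le_mul_summable {x y : ℕ → ℝ} (hx : ∀ n, 0 ≤ x n) (hy : Summable y)
    (hxy : ∀ K : ℕ, ∑ n ∈ Finset.range (K + 2), x n ≤ ((K : ℝ) + 3) * y K) (n : ℕ) : x n = 0 := by
  by_contra hne
  have hpos : 0 < x n := lt_of_le_of_ne (hx n) (Ne.symm hne)
  -- A nonzero entry would bound `y K` below by a multiple of the harmonic series.
  have hlow : ∀ K, n ≤ K → x n * (1 / ((K : ℝ) + 3)) ≤ y K := by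
    intro K hK
    have h1 : x n ≤ ∑ i ∈ Finset.range (K + 2), x i :=
      Finset.single_le_sum (fun i _ => hx i) (Finset.mem_range.2 (by omega))
    have h2 := h1.trans (hxy K)
    rw [mul_one_div, div_le_iff₀ (by positivity), mul_comm (y K)]
    exact h2
  have hs : Summable fun K : ℕ => x n * (1 / (((K + n : ℕ) : ℝ) + 3)) :=
    Summable.of_nonneg_of_le (fun K => by positivity) (fun K => hlow (K + n) (by omega))
      ((summable_nat_add_iff n).2 hy)
  have hs2 : Summable fun K : ℕ => 1 / (((K + (n + 3) : ℕ) : ℝ)) := by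
    have := hs.mul_left (x n)⁻¹
    refine this.congr fun K => ?_
    rw [← mul_assoc, inv_mul_cancel₀ hpos.ne', one_mul]
    push_cast
    ring_nf
  exact Real.not_summable_one_div_natCast ((summable_nat_add_iff (n + 3)).1 hs2)

theorem summable_norm_sq (g : Fock) : Summable fun n => ‖g n‖ ^ 2 := by
  have := (lp.memℓp g).summable (by norm_num)
  simpa using this

/-- The matrix entries grow at most linearly, so the flux through level `K` is at most `K + 3` times
a sum of four neighbouring shifts of the summable sequence `‖g n‖²`. Linear growth is the borderline
at which comparison with the harmonic series still works. -/
theorem deficiency_eq_zero {l : ℝ} {k : ℂ} {g : Fock}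
    (hg : ∀ n : ℕ, ⟪(quadOp l k (numVec n) : Fock), g⟫_ℂ = Complex.I * g n) : g = 0 := by
  simp only [inner_quadOp_numVec] at hg
  have hs := summable_norm_sq g
  set x : ℕ → ℝ := fun n => ‖g n‖ ^ 2 with hx
  have hx0 : ∀ n, 0 ≤ x n := fun n => by positivity
  have hy : Summable fun K => (|l| + ‖k‖) * (x K + x (K + 1) + x (K + 2) + x (K + 3)) :=
    (((hs.add ((summable_nat_add_iff 1).2 hs)).add ((summable_nat_add_iff 2).2 hs)).add
      ((summable_nat_add_iff 3).2 hs)).mul_left _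
  have h0 := eq_zero_of_sum_le_mul_summable hx0 hy (by
    intro K
    rw [sum_norm_sq_eq_flux hg K]
    have hsq : ∀ c d : ℝ, 0 ≤ c → c ≤ d → d ≤ (K : ℝ) + 3 → ‖((√c * √d : ℝ) : ℂ)‖ ≤ (K : ℝ) + 3 := by
      intro c d hc hcd hd
      rw [Complex.norm_real, Real.norm_eq_abs, abs_of_nonneg (by positivity)]
      calc √c * √d ≤ √((K : ℝ) + 3) * √((K : ℝ) + 3) := by
            gcongr
            linarith
        _ = _ := Real.mul_self_sqrt (by positivity)
    have b1 := (Complex.abs_im_le_norm _).trans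
      (norm_mul_le_half_sq ((√((K : ℝ) + 2) * √((K : ℝ) + 3) : ℝ) : ℂ) (g (K + 1)) (g (K + 3)))
    have b2 := (Complex.abs_im_le_norm _).trans
      (norm_mul_le_half_sq ((√((K : ℝ) + 1) * √((K : ℝ) + 2) : ℝ) : ℂ) (g K) (g (K + 2)))
    have b3 := (Complex.abs_im_le_norm _).trans
      (norm_mul_le_half_sq (k * √((K : ℝ) + 2)) (g (K + 1)) (g (K + 2)))
    have c1 := hsq (K + 2) (K + 3) (by positivity) (by linarith) le_rfl
    have c2 := hsq (K + 1) (K + 2) (by positivity) (by linarith) (by linarith)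
    have c3 : ‖k * (√((K : ℝ) + 2) : ℂ)‖ ≤ ‖k‖ * ((K : ℝ) + 3) := by
      rw [norm_mul]
      gcongr
      rw [Complex.norm_real, Real.norm_eq_abs, abs_of_nonneg (by positivity)]
      rw [Real.sqrt_le_left (by positivity)]
      nlinarith [(Nat.cast_nonneg K : (0 : ℝ) ≤ K)]
    have d1 := b1.trans (mul_le_mul_of_nonneg_right c1 (add_nonneg (hx0 (K + 1)) (hx0 (K + 3))))
    have d2 := b2.trans (mul_le_mul_of_nonneg_right c2 (add_nonneg (hx0 K) (hx0 (K + 2))))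
    have d3 := b3.trans (mul_le_mul_of_nonneg_right c3 (add_nonneg (hx0 (K + 1)) (hx0 (K + 2))))
    have t1 : ∀ p q : ℝ, l * (p + q) ≤ |l| * (|p| + |q|) := fun p q => by
      calc l * (p + q) ≤ |l * (p + q)| := le_abs_self _
        _ = |l| * |p + q| := abs_mul _ _
        _ ≤ _ := by gcongr; exact abs_add_le _ _
    refine (add_le_add (t1 _ _) (le_abs_self _)).trans ?_
    refine (add_le_add (mul_le_mul_of_nonneg_left (add_le_add d1 d2) (abs_nonneg l)) d3).trans ?_
    have hk : 0 ≤ ‖k‖ * ((K : ℝ) + 3) * (x K + x (K + 3)) := by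
      have := hx0 K
      have := hx0 (K + 3)
      positivity
    linarith)
  apply lp.ext
  funext n
  have := h0 n
  rw [hx] at this
  simpa using this

theorem dense_range_quadOp_add_I (l : ℝ) (k : ℂ) :
    (Submodule.span ℂ (Set.range fun n => (quadOp l k (numVec n) : Fock)
      + Complex.I • (numVec n : Fock))).topologicalClosure = ⊤ := by
  rw [Submodule.topologicalClosure_eq_top_iff, Submodule.eq_bot_iff]
  intro g hg
  rw [Submodule.mem_orthogonal] at hg
  refine deficiency_eq_zero (l := l) (k := k) fun n => ?_
  have h1 := hg _ (Submodule.subset_span ⟨n, rfl⟩)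
  rw [inner_add_left, inner_smul_left, inner_numVec, Complex.conj_I] at h1
  linear_combination h1

theorem dense_smooth : Dense (smooth : Set Fock) := by
  rw [Submodule.dense_iff_topologicalClosure_eq_top, eq_top_iff, ← span_expVec]
  apply Submodule.topologicalClosure_mono
  rw [Submodule.span_le]
  rintro _ ⟨c, rfl⟩
  exact (expVec c).2

/-- Reduces diagonalization of the closure to an intertwining relation on the number vectors. -/
theorem isMulOperator_quadOp {Ω : Type*} [MeasurableSpace Ω] {ν : Measure Ω}
    {U : Fock ≃ₗᵢ[ℂ] Lp ℂ 2 ν} {m : Ω → ℝ} (hm : Measurable m) {l : ℝ} {k : ℂ}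
    (hU : ∀ n, U (quadOp l k (numVec n)) =ᵐ[ν] fun x => (m x : ℂ) * U (numVec n) x) :
    IsMulOperator (LinearPMap.closure ⟨smooth, smooth.subtype ∘ₗ quadOp l k⟩) U m :=
  isMulOperator_closure dense_smooth (inner_quadOp l k) hm numVec hU (dense_range_quadOp_add_I l k)

end Fock

end CEHeis

namespace CEHeis

open Filter Topology Polynomial
open scoped SchwartzMap ContDiff

/-! ### Polynomials times Gaussians -/

section GaussPoly

/-- The function `Q e^R` on the real line. -/
noncomputable def gaussPoly (Q R : ℂ[X]) (x : ℝ) : ℂ := Q.eval (x : ℂ) * Complex.exp (R.eval (x : ℂ))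

/-- `e^R` decays at least like a Gaussian. -/
def GaussBound (R : ℂ[X]) : Prop :=
  ∃ c : ℝ, 0 < c ∧ ∃ C : ℝ, ∀ x : ℝ, (R.eval (x : ℂ)).re ≤ C - c * x ^ 2

theorem hasDerivAt_gaussPoly (Q R : ℂ[X]) (x : ℝ) :
    HasDerivAt (gaussPoly Q R) (gaussPoly (derivative Q + Q * derivative R) R x) x := by
  have h1 : HasDerivAt (fun w : ℂ => Q.eval w * Complex.exp (R.eval w))
      ((derivative Q).eval (x : ℂ) * Complex.exp (R.eval (x : ℂ)) +
        Q.eval (x : ℂ) * (Complex.exp (R.eval (x : ℂ)) * (derivative R).eval (x : ℂ))) (x : ℂ) :=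
    (Q.hasDerivAt _).mul (R.hasDerivAt _).cexp
  have h2 := h1.comp_ofReal
  convert! h2 using 1
  simp only [gaussPoly, eval_add, eval_mul]
  ring

theorem deriv_gaussPoly (Q R : ℂ[X]) :
    deriv (gaussPoly Q R) = gaussPoly (derivative Q + Q * derivative R) R :=
  funext fun x => (hasDerivAt_gaussPoly Q R x).deriv

theorem gaussPoly_add (P Q R : ℂ[X]) : gaussPoly (P + Q) R = gaussPoly P R + gaussPoly Q R := by
  funext x
  simp [gaussPoly, add_mul]

theorem gaussPoly_mul (P Q R : ℂ[X]) (x : ℝ) :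
    gaussPoly (P * Q) R x = P.eval (x : ℂ) * gaussPoly Q R x := by
  simp [gaussPoly, mul_assoc]

theorem gaussPoly_smul (c : ℂ) (Q R : ℂ[X]) : gaussPoly (c • Q) R = c • gaussPoly Q R := by
  funext x
  simp [gaussPoly, mul_assoc]

theorem GaussBound.bounded {R : ℂ[X]} (hR : GaussBound R) (Q : ℂ[X]) :
    ∃ C : ℝ, ∀ x, ‖gaussPoly Q R x‖ ≤ C := by
  obtain ⟨c, hc, C, hC⟩ := hR
  induction Q using Polynomial.induction_on' with
  | add P Q hP hQ =>
    obtain ⟨A, hA⟩ := hP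
    obtain ⟨B, hB⟩ := hQ
    refine ⟨A + B, fun x => ?_⟩
    rw [gaussPoly_add]
    exact (norm_add_le _ _).trans (add_le_add (hA x) (hB x))
  | monomial n a =>
    -- From `|x|ⁿ ≤ n! e^{|x|}` and `|x| - c x² ≤ 1/(4c)`, the latter by completing the square.
    refine ⟨‖a‖ * ((n.factorial : ℝ) * Real.exp (C + 1 / (4 * c))), fun x => ?_⟩
    rw [gaussPoly, eval_monomial, norm_mul, norm_mul, norm_pow, Complex.norm_exp, Complex.norm_real,
      Real.norm_eq_abs, mul_assoc]
    refine mul_le_mul_of_nonneg_left ?_ (norm_nonneg a)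
    have h1 : |x| ^ n ≤ (n.factorial : ℝ) * Real.exp |x| := by
      have := Real.pow_div_factorial_le_exp |x| (abs_nonneg x) n
      rwa [div_le_iff₀ (by positivity), mul_comm] at this
    calc |x| ^ n * Real.exp ((R.eval (x : ℂ)).re)
        ≤ ((n.factorial : ℝ) * Real.exp |x|) * Real.exp (C - c * x ^ 2) := by
          gcongr
          exact hC x
      _ = (n.factorial : ℝ) * Real.exp (|x| + (C - c * x ^ 2)) := by rw [Real.exp_add]; ring
      _ ≤ _ := by
          refine mul_le_mul_of_nonneg_left (Real.exp_le_exp.2 ?_) (by positivity)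
          have : |x| - c * x ^ 2 ≤ 1 / (4 * c) := by
            rw [le_div_iff₀ (by positivity), ← sq_abs]
            nlinarith [sq_nonneg (2 * c * |x| - 1)]
          linarith

theorem exists_iteratedDeriv_gaussPoly (n : ℕ) (Q R : ℂ[X]) :
    ∃ P : ℂ[X], iteratedDeriv n (gaussPoly Q R) = gaussPoly P R := by
  induction n generalizing Q with
  | zero => exact ⟨Q, iteratedDeriv_zero⟩
  | succ n ih =>
    rw [iteratedDeriv_succ', deriv_gaussPoly]
    exact ih _

/-- `Q e^R` as a Schwartz function. -/
noncomputable def gaussSchwartz {R : ℂ[X]} (hR : GaussBound R) (Q : ℂ[X]) : 𝓢(ℝ, ℂ) where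
  toFun := gaussPoly Q R
  smooth' := contDiff_of_differentiable_iteratedDeriv fun n _ => by
    obtain ⟨P, hP⟩ := exists_iteratedDeriv_gaussPoly n Q R
    rw [hP]
    exact fun x => (hasDerivAt_gaussPoly P R x).differentiableAt
  decay' k n := by
    obtain ⟨P, hP⟩ := exists_iteratedDeriv_gaussPoly n Q R
    obtain ⟨C, hC⟩ := hR.bounded (Polynomial.X ^ k * P)
    refine ⟨C, fun x => ?_⟩
    rw [norm_iteratedFDeriv_eq_norm_iteratedDeriv, hP]
    have := hC x
    rw [gaussPoly_mul, norm_mul] at this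
    simpa using this

theorem gaussSchwartz_apply {R : ℂ[X]} (hR : GaussBound R) (Q : ℂ[X]) (x : ℝ) :
    gaussSchwartz hR Q x = gaussPoly Q R x := rfl

theorem coe_gaussSchwartz {R : ℂ[X]} (hR : GaussBound R) (Q : ℂ[X]) :
    ⇑(gaussSchwartz hR Q) = gaussPoly Q R := rfl

theorem GaussBound.integrable {R : ℂ[X]} (hR : GaussBound R) (Q : ℂ[X]) :
    Integrable (gaussPoly Q R) :=
  (gaussSchwartz hR Q).integrable

theorem GaussBound.memLp {R : ℂ[X]} (hR : GaussBound R) (Q : ℂ[X]) :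
    MemLp (gaussPoly Q R) 2 :=
  (gaussSchwartz hR Q).memLp 2 volume

theorem GaussBound.integral_derivative {R : ℂ[X]} (hR : GaussBound R) (Q : ℂ[X]) :
    ∫ x, gaussPoly (derivative Q + Q * derivative R) R x = 0 :=
  integral_eq_zero_of_hasDerivAt_of_integrable (hasDerivAt_gaussPoly Q R) (hR.integrable _)
    (hR.integrable _)

/-- The shift of the integration contour for functions of Gaussian decay. -/
theorem integral_shift_of_gaussian_decay {f : ℂ → ℂ} (hf : Differentiable ℂ f) {σ c C : ℝ}
    (hc : 0 < c) (hb : ∀ x : ℝ, ∀ y ∈ Set.uIcc 0 σ, ‖f (x + y * Complex.I)‖ ≤ Real.exp (C - c * x ^ 2)) :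
    ∫ x : ℝ, f (x + σ * Complex.I) = ∫ x : ℝ, f x := by
  have hint : ∀ y ∈ Set.uIcc 0 σ, Integrable fun x : ℝ => f (x + y * Complex.I) := by
    intro y hy
    refine Integrable.mono' (g := fun x => Real.exp C * Real.exp (-c * x ^ 2))
      ((integrable_exp_neg_mul_sq hc).const_mul _) ?_ (Eventually.of_forall fun x => ?_)
    · exact (hf.continuous.comp (by fun_prop)).aestronglyMeasurable
    · rw [← Real.exp_add]
      refine (hb x y hy).trans (le_of_eq ?_)
      ring_nf
  have hT : Tendsto (fun T : ℝ => Real.exp (C - c * T ^ 2) * |σ|) atTop (𝓝 0) := by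
    have h1 : Tendsto (fun T : ℝ => C - c * T ^ 2) atTop atBot := by
      have h2 : Tendsto (fun T : ℝ => c * T ^ 2) atTop atTop :=
        (tendsto_pow_atTop two_ne_zero).const_mul_atTop hc
      simpa [sub_eq_add_neg] using tendsto_atBot_add_const_left _ C (tendsto_neg_atTop_atBot.comp h2)
    simpa using (Real.tendsto_exp_atBot.comp h1).mul_const |σ|
  -- The vertical sides of the rectangle, at `T` and at `-T` through the sign `e`, vanish in the
  -- limit by Gaussian decay.
  have hvert : ∀ e : ℝ, |e| = 1 → Tendsto (fun T : ℝ =>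
      Complex.I • ∫ y : ℝ in (0 : ℝ)..σ, f (((e * T : ℝ) : ℂ) + y * Complex.I)) atTop (𝓝 0) := by
    intro e he
    refine squeeze_zero_norm (fun T => ?_) hT
    rw [norm_smul, Complex.norm_I, one_mul]
    have := intervalIntegral.norm_integral_le_of_norm_le_const (a := 0) (b := σ)
      (f := fun y : ℝ => f (((e * T : ℝ) : ℂ) + y * Complex.I)) (C := Real.exp (C - c * T ^ 2))
      (fun y hy => by
        refine (hb (e * T) y (Set.uIoc_subset_uIcc hy)).trans (le_of_eq ?_)
        rw [mul_pow, ← sq_abs e, he]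
        ring_nf)
    simpa using this
  have hrect : ∀ T : ℝ, (∫ x : ℝ in (-T)..T, f x) - (∫ x : ℝ in (-T)..T, f (x + σ * Complex.I))
      = -(Complex.I • ∫ y : ℝ in (0 : ℝ)..σ, f (((1 * T : ℝ) : ℂ) + y * Complex.I))
        + Complex.I • ∫ y : ℝ in (0 : ℝ)..σ, f (((-1 * T : ℝ) : ℂ) + y * Complex.I) := by
    intro T
    have := Complex.integral_boundary_rect_eq_zero_of_differentiableOn f ((-T : ℝ) : ℂ)
      ((T : ℂ) + σ * Complex.I) hf.differentiableOn
    simp only [Complex.ofReal_re, Complex.ofReal_im, Complex.add_re, Complex.add_im,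
      Complex.mul_re, Complex.mul_im, Complex.I_re, Complex.I_im, mul_zero, mul_one, sub_zero,
      add_zero, zero_add, Complex.ofReal_zero, zero_mul] at this
    rw [one_mul, neg_one_mul]
    linear_combination this
  have h1 := intervalIntegral_tendsto_integral (hint 0 Set.left_mem_uIcc)
    tendsto_neg_atTop_atBot tendsto_id
  have h2 := intervalIntegral_tendsto_integral (hint σ Set.right_mem_uIcc)
    tendsto_neg_atTop_atBot tendsto_id
  have h3 := h1.sub h2
  have h4 := ((hvert 1 (by simp)).neg).add (hvert (-1) (by simp))
  simp only [Complex.ofReal_zero, zero_mul, add_zero, id] at h3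
  rw [funext hrect] at h3
  have h5 := tendsto_nhds_unique h3 h4
  rw [neg_zero, add_zero] at h5
  exact (sub_eq_zero.1 h5).symm

/-- An integrable function whose Fourier transform vanishes is zero. -/
theorem ae_eq_zero_of_fourier_eq_zero {G : ℝ → ℂ} (hG : Integrable G)
    (h : ∀ ξ : ℝ, ∫ x : ℝ, Complex.exp (((-2 * Real.pi * x * ξ : ℝ) : ℂ) * Complex.I) * G x = 0) :
    ∀ᵐ x, G x = 0 := by
  apply ae_eq_zero_of_integral_contDiff_smul_eq_zero hG.locallyIntegrable
  intro g hg hgs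
  have hF : FourierTransform.fourier G = 0 := by
    funext ξ
    rw [Real.fourier_real_eq_integral_exp_smul]
    simpa using h ξ
  have hgs' : HasCompactSupport fun x => (g x : ℂ) := hgs.comp_left (g := Complex.ofReal) rfl
  let η : 𝓢(ℝ, ℂ) := hgs'.toSchwartzMap (Complex.ofRealCLM.contDiff.comp hg)
  -- A test function is the Fourier transform of a Schwartz function; the multiplication formula
  -- moves the transform onto `G`, where it vanishes.
  have h1 := VectorFourier.integral_fourierIntegral_smul_eq_flip (L := innerₗ ℝ)
    (μ := volume) (ν := volume) Real.continuous_fourierChar continuous_inner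
    ((FourierTransform.fourierInv η : 𝓢(ℝ, ℂ)).integrable) hG
  rw [flip_innerₗ] at h1
  have h2 : (fun ξ => VectorFourier.fourierIntegral Real.fourierChar volume (innerₗ ℝ)
      (FourierTransformInv.fourierInv η : 𝓢(ℝ, ℂ)) ξ • G ξ) = fun ξ => g ξ • G ξ := by
    funext ξ
    have h3 : FourierTransform.fourier (FourierTransformInv.fourierInv η : 𝓢(ℝ, ℂ)) = η :=
      FourierTransform.fourier_fourierInv_eq η
    have h4 := congrArg (fun f : 𝓢(ℝ, ℂ) => f ξ) h3
    rw [SchwartzMap.fourier_coe] at h4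
    change VectorFourier.fourierIntegral Real.fourierChar volume (innerₗ ℝ)
      (FourierTransformInv.fourierInv η : 𝓢(ℝ, ℂ)) ξ = _ at h4
    rw [h4, Complex.real_smul]
    rfl
  have h5 : VectorFourier.fourierIntegral Real.fourierChar volume (innerₗ ℝ) G = 0 := hF
  rw [h2, h5] at h1
  simpa using h1

end GaussPoly

end CEHeis

namespace CEHeis

open Filter Topology Polynomial
open scoped SchwartzMap ContDiff

/-! ### Hermite functions with a phase -/

section Hermite

/-- The normalizing constant `(2π)^(-1/4)`. -/
noncomputable def gaussConst : ℝ := √((√(2 * Real.pi))⁻¹)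

theorem gaussConst_sq : gaussConst * gaussConst = (√(2 * Real.pi))⁻¹ :=
  Real.mul_self_sqrt (by positivity)

theorem gaussConst_ne_zero : gaussConst ≠ 0 := by
  rw [gaussConst]
  positivity

/-- Normalized Hermite polynomials with the phases `(-i)ⁿ`. -/
noncomputable def hermPoly : ℕ → ℂ[X]
  | 0 => C (gaussConst : ℂ)
  | 1 => (-Complex.I) • (Polynomial.X * C (gaussConst : ℂ))
  | n + 2 => ((√((n : ℝ) + 2) : ℂ))⁻¹ • ((-Complex.I) • (Polynomial.X * hermPoly (n + 1))
      + (√((n : ℝ) + 1) : ℂ) • hermPoly n)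

theorem hermPoly_zero : hermPoly 0 = C (gaussConst : ℂ) := by rw [hermPoly]

theorem hermPoly_succ (n : ℕ) : (√((n : ℝ) + 1) : ℂ) • hermPoly (n + 1) =
    (-Complex.I) • (Polynomial.X * hermPoly n) + (√(n : ℝ) : ℂ) • hermPoly (n - 1) := by
  rcases n with _ | n
  · simp [hermPoly]
  · have h0 : (√((n : ℝ) + 2) : ℂ) ≠ 0 := by
      rw [Complex.ofReal_ne_zero]
      positivity
    rw [hermPoly, smul_smul]
    push_cast
    rw [show (n : ℝ) + 1 + 1 = n + 2 by ring, mul_inv_cancel₀ h0, one_smul]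

/-- Differentiate the three-term recurrence. Strong induction is needed because it involves two
predecessors. -/
theorem derivative_hermPoly (n : ℕ) :
    derivative (hermPoly n) = (-Complex.I * (√(n : ℝ) : ℂ)) • hermPoly (n - 1) := by
  induction n using Nat.strong_induction_on with
  | _ n ih =>
  rcases n with _ | n
  · simp [hermPoly]
  have h0 : (√((n : ℝ) + 1) : ℂ) ≠ 0 := by
    rw [Complex.ofReal_ne_zero]
    positivity
  have hsq : ∀ t : ℝ, 0 ≤ t → (√t : ℂ) * (√t : ℂ) = t := by
    intro t ht
    rw [← Complex.ofReal_mul, Real.mul_self_sqrt ht]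
  have h1 := congrArg derivative (hermPoly_succ n)
  rw [derivative_smul, derivative_add, derivative_smul, derivative_smul, derivative_mul,
    derivative_X, one_mul, ih n (Nat.lt_succ_self n), ih (n - 1) (by omega)] at h1
  apply smul_right_injective _ h0
  simp only
  rw [h1, Nat.add_sub_cancel]
  rcases n with _ | n
  · simp
  have h2 := hermPoly_succ n
  simp only [Nat.add_sub_cancel]
  have h3 : (√(n : ℝ) : ℂ) • hermPoly (n - 1) = (√((n : ℝ) + 1) : ℂ) • hermPoly (n + 1)
      + Complex.I • (Polynomial.X * hermPoly n) := by
    rw [h2]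
    module
  have h4 := hsq ((n : ℝ) + 1) (by positivity)
  have h5 := hsq ((n : ℝ) + 1 + 1) (by positivity)
  push_cast at h4 h5 ⊢
  rw [mul_smul (-Complex.I) (√(n : ℝ) : ℂ), h3, mul_smul_comm]
  match_scalars
  · linear_combination (-Complex.I) * h4 + Complex.I * h5
  · linear_combination (0 : ℂ) * Complex.I_sq

/-- The exponent `-x²/4 + i θ(x)`. -/
noncomputable def phaseExp (θ : ℝ[X]) : ℂ[X] :=
  C (-1 / 4) * Polynomial.X ^ 2 + C Complex.I * θ.map Complex.ofRealHom

theorem eval_phaseExp (θ : ℝ[X]) (x : ℝ) :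
    (phaseExp θ).eval (x : ℂ) = ((-x ^ 2 / 4 : ℝ) : ℂ) + Complex.I * ((θ.eval x : ℝ) : ℂ) := by
  have : (θ.map Complex.ofRealHom).eval (x : ℂ) = ((θ.eval x : ℝ) : ℂ) :=
    eval_map_apply (f := Complex.ofRealHom) x
  simp only [phaseExp, eval_add, eval_mul, eval_C, eval_pow, eval_X, this]
  push_cast
  ring

theorem gaussBound_phaseExp (θ : ℝ[X]) : GaussBound (phaseExp θ) := by
  refine ⟨1 / 4, by norm_num, 0, fun x => le_of_eq ?_⟩
  rw [eval_phaseExp, Complex.add_re, Complex.ofReal_re]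
  simp
  ring

/-- `e^{-x²/2}`, the square of the ground state. -/
theorem gaussBound_half : GaussBound (C (-1 / 2) * Polynomial.X ^ 2) := by
  refine ⟨1 / 2, by norm_num, 0, fun x => le_of_eq ?_⟩
  have h1 : (C (-1 / 2 : ℂ) * Polynomial.X ^ 2).eval (x : ℂ) = ((-1 / 2 * x ^ 2 : ℝ) : ℂ) := by
    simp only [eval_mul, eval_C, eval_pow, eval_X]
    push_cast
    ring
  rw [h1, Complex.ofReal_re]
  ring

theorem eval_map_conj (Q : ℂ[X]) (x : ℝ) :
    (Q.map (starRingEnd ℂ)).eval (x : ℂ) = conj (Q.eval (x : ℂ)) := by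
  have := eval_map_apply (p := Q) (f := starRingEnd ℂ) (x : ℂ)
  rwa [Complex.conj_ofReal] at this

/-- The phases cancel because `θ` is real, so all inner products are independent of `θ`. -/
theorem inner_gaussPoly (θ : ℝ[X]) (P Q : ℂ[X]) (x : ℝ) :
    ⟪gaussPoly P (phaseExp θ) x, gaussPoly Q (phaseExp θ) x⟫_ℂ =
      gaussPoly (P.map (starRingEnd ℂ) * Q) (C (-1 / 2) * Polynomial.X ^ 2) x := by
  rw [RCLike.inner_apply]
  simp only [gaussPoly, eval_mul, eval_map_conj, map_mul, eval_C, eval_pow, eval_X]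
  rw [← Complex.exp_conj, eval_phaseExp]
  simp only [map_add, map_mul, Complex.conj_ofReal, Complex.conj_I]
  rw [mul_mul_mul_comm, ← Complex.exp_add, mul_comm (Q.eval (x : ℂ))]
  congr 2
  push_cast
  ring

/-- The Gaussian moment functional. -/
noncomputable def gaussGram (P Q : ℂ[X]) : ℂ :=
  ∫ x, gaussPoly (P.map (starRingEnd ℂ) * Q) (C (-1 / 2) * Polynomial.X ^ 2) x

theorem gaussGram_add_right (P Q R : ℂ[X]) :
    gaussGram P (Q + R) = gaussGram P Q + gaussGram P R := by
  rw [gaussGram, mul_add, gaussPoly_add]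
  exact integral_add (gaussBound_half.integrable _) (gaussBound_half.integrable _)

theorem gaussGram_smul_right (c : ℂ) (P Q : ℂ[X]) : gaussGram P (c • Q) = c * gaussGram P Q := by
  rw [gaussGram, mul_smul_comm, gaussPoly_smul]
  exact integral_const_mul _ _

theorem gaussGram_conj (P Q : ℂ[X]) : conj (gaussGram P Q) = gaussGram Q P := by
  rw [gaussGram, gaussGram, ← integral_conj]
  congr 1
  funext x
  have h1 := inner_gaussPoly 0 P Q x
  have h2 := inner_gaussPoly 0 Q P x
  rw [← h1, ← h2, inner_conj_symm]

theorem gaussGram_add_left (P Q R : ℂ[X]) :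
    gaussGram (P + Q) R = gaussGram P R + gaussGram Q R := by
  rw [← gaussGram_conj, gaussGram_add_right, map_add, gaussGram_conj, gaussGram_conj]

theorem gaussGram_smul_left (c : ℂ) (P Q : ℂ[X]) :
    gaussGram (c • P) Q = conj c * gaussGram P Q := by
  rw [← gaussGram_conj, gaussGram_smul_right, map_mul, gaussGram_conj]

theorem gaussGram_X_mul (P Q : ℂ[X]) :
    gaussGram (Polynomial.X * P) Q = gaussGram P (Polynomial.X * Q) := by
  rw [gaussGram, gaussGram, Polynomial.map_mul, map_X, mul_assoc, mul_left_comm]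

/-- Integration by parts against the Gaussian. -/
theorem gaussGram_derivative (P Q : ℂ[X]) :
    gaussGram (derivative P) Q + gaussGram P (derivative Q) = gaussGram P (Polynomial.X * Q) := by
  have h1 := gaussBound_half.integral_derivative (P.map (starRingEnd ℂ) * Q)
  have h2 : derivative (P.map (starRingEnd ℂ) * Q) + P.map (starRingEnd ℂ) * Q *
      derivative (C (-1 / 2 : ℂ) * Polynomial.X ^ 2) =
      ((derivative P).map (starRingEnd ℂ) * Q + P.map (starRingEnd ℂ) * derivative Q)
        + (-1 : ℂ) • (P.map (starRingEnd ℂ) * (Polynomial.X * Q)) := by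
    have h3 : derivative (C (-1 / 2 : ℂ) * Polynomial.X ^ 2) = -Polynomial.X := by
      rw [derivative_C_mul, derivative_X_pow]
      simp only [Nat.cast_ofNat, Nat.add_one_sub_one, pow_one]
      rw [← mul_assoc, ← C_mul]
      norm_num
    rw [derivative_mul, derivative_map, h3, neg_smul, one_smul]
    ring
  rw [h2, gaussPoly_add, gaussPoly_add, gaussPoly_smul] at h1
  rw [integral_add' ((gaussBound_half.integrable _).add (gaussBound_half.integrable _))
    ((gaussBound_half.integrable _).smul _), integral_add' (gaussBound_half.integrable _)
    (gaussBound_half.integrable _)] at h1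
  simp only [Pi.smul_apply] at h1
  rw [integral_smul] at h1
  rw [gaussGram, gaussGram, gaussGram]
  simp only [smul_eq_mul] at h1
  linear_combination h1

/-- Integration by parts makes raising adjoint to lowering, so both indices drop by one;
orthonormality follows by induction from the Gaussian integral. -/
theorem gaussGram_hermPoly_succ_left (m n : ℕ) :
    (√((m : ℝ) + 1) : ℂ) * gaussGram (hermPoly (m + 1)) (hermPoly n) =
      (√(n : ℝ) : ℂ) * gaussGram (hermPoly m) (hermPoly (n - 1)) := by
  have h1 := gaussGram_derivative (hermPoly m) (hermPoly n)
  rw [derivative_hermPoly, derivative_hermPoly, gaussGram_smul_left, gaussGram_smul_right,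
    ← gaussGram_X_mul, map_mul, map_neg, Complex.conj_I, Complex.conj_ofReal] at h1
  have h2 := congrArg (fun P => gaussGram P (hermPoly n)) (hermPoly_succ m)
  simp only [gaussGram_add_left, gaussGram_smul_left, Complex.conj_ofReal, map_neg,
    Complex.conj_I] at h2
  rw [← h1] at h2
  linear_combination h2 + ((√(m : ℝ) : ℂ) * gaussGram (hermPoly (m - 1)) (hermPoly n)
    - (√(n : ℝ) : ℂ) * gaussGram (hermPoly m) (hermPoly (n - 1))) * Complex.I_sq

theorem gaussGram_hermPoly (m n : ℕ) :
    gaussGram (hermPoly m) (hermPoly n) = if m = n then 1 else 0 := by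
  have hne : ∀ k : ℕ, (√((k : ℝ) + 1) : ℂ) ≠ 0 := by
    intro k
    rw [Complex.ofReal_ne_zero]
    positivity
  have hz : ∀ m, gaussGram (hermPoly (m + 1)) (hermPoly 0) = 0 := by
    intro m
    have h := gaussGram_hermPoly_succ_left m 0
    rw [Nat.cast_zero, Real.sqrt_zero, Complex.ofReal_zero, zero_mul] at h
    exact (mul_eq_zero.1 h).resolve_left (hne m)
  induction m generalizing n with
  | zero =>
    rcases n with _ | n
    · have h1 : ∀ x : ℝ, gaussPoly (C (conj (gaussConst : ℂ)) * C (gaussConst : ℂ))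
          (C (-1 / 2) * Polynomial.X ^ 2) x
          = (((√(2 * Real.pi))⁻¹ * Real.exp (-(1 / 2) * x ^ 2) : ℝ) : ℂ) := by
        intro x
        rw [← C_mul, Complex.conj_ofReal, ← Complex.ofReal_mul, gaussConst_sq, gaussPoly]
        simp only [eval_mul, eval_C, eval_pow, eval_X]
        push_cast
        congr 2
        ring
      rw [gaussGram, hermPoly_zero, map_C, funext h1, integral_complex_ofReal, integral_const_mul,
        integral_gaussian, show Real.pi / (1 / 2) = 2 * Real.pi by ring,
        inv_mul_cancel₀ (by positivity)]
      simp
    · rw [← gaussGram_conj, hz]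
      simp
  | succ m ih =>
    rcases n with _ | n
    · rw [hz]
      simp
    · have h := gaussGram_hermPoly_succ_left m (n + 1)
      rw [Nat.add_sub_cancel, ih n] at h
      by_cases hmn : m = n
      · subst hmn
        push_cast at h
        rw [if_pos rfl] at h ⊢
        exact mul_left_cancel₀ (hne m) h
      · rw [if_neg hmn, mul_zero] at h
        rw [if_neg (by omega)]
        exact (mul_eq_zero.1 h).resolve_left (hne m)

/-- `Q e^{-x²/4 + iθ}` as an element of `L²`. -/
noncomputable def phaseLp (θ : ℝ[X]) : ℂ[X] →ₗ[ℂ] Lp ℂ 2 (volume : Measure ℝ) where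
  toFun Q := (gaussSchwartz (gaussBound_phaseExp θ) Q).toLp 2
  map_add' P Q := by
    apply Lp.ext
    filter_upwards [(gaussSchwartz (gaussBound_phaseExp θ) (P + Q)).coeFn_toLp 2,
      (gaussSchwartz (gaussBound_phaseExp θ) P).coeFn_toLp 2,
      (gaussSchwartz (gaussBound_phaseExp θ) Q).coeFn_toLp 2,
      Lp.coeFn_add ((gaussSchwartz (gaussBound_phaseExp θ) P).toLp 2)
        ((gaussSchwartz (gaussBound_phaseExp θ) Q).toLp 2)] with x h1 h2 h3 h4
    rw [h1, h4, Pi.add_apply, h2, h3, coe_gaussSchwartz, gaussPoly_add]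
    rfl
  map_smul' c Q := by
    apply Lp.ext
    filter_upwards [(gaussSchwartz (gaussBound_phaseExp θ) (c • Q)).coeFn_toLp 2,
      (gaussSchwartz (gaussBound_phaseExp θ) Q).coeFn_toLp 2,
      Lp.coeFn_smul c ((gaussSchwartz (gaussBound_phaseExp θ) Q).toLp 2)] with x h1 h2 h3
    rw [h1, RingHom.id_apply, h3, Pi.smul_apply, h2, coe_gaussSchwartz, gaussPoly_smul]
    rfl

theorem phaseLp_eq (θ : ℝ[X]) (Q : ℂ[X]) :
    phaseLp θ Q = (gaussSchwartz (gaussBound_phaseExp θ) Q).toLp 2 := rfl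

theorem coeFn_phaseLp (θ : ℝ[X]) (Q : ℂ[X]) : phaseLp θ Q =ᵐ[volume] gaussPoly Q (phaseExp θ) :=
  (gaussSchwartz (gaussBound_phaseExp θ) Q).coeFn_toLp 2

theorem inner_phaseLp (θ : ℝ[X]) (P Q : ℂ[X]) : ⟪phaseLp θ P, phaseLp θ Q⟫_ℂ = gaussGram P Q := by
  rw [L2.inner_def, gaussGram]
  apply integral_congr_ae
  filter_upwards [coeFn_phaseLp θ P, coeFn_phaseLp θ Q] with x h1 h2
  rw [h1, h2, inner_gaussPoly]

theorem orthonormal_phaseLp (θ : ℝ[X]) : Orthonormal ℂ fun n => phaseLp θ (hermPoly n) := by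
  rw [orthonormal_iff_ite]
  intro i j
  rw [inner_phaseLp, gaussGram_hermPoly]

/-- The recurrence solved for `X * hermPoly n` shows that the span is stable under multiplication by
`X`; it contains the constants. -/
theorem span_hermPoly : Submodule.span ℂ (Set.range hermPoly) = ⊤ := by
  set S := Submodule.span ℂ (Set.range hermPoly)
  have hmem : ∀ n, hermPoly n ∈ S := fun n => Submodule.subset_span ⟨n, rfl⟩
  have hX : ∀ Q ∈ S, Polynomial.X * Q ∈ S := by
    intro Q hQ
    induction hQ using Submodule.span_induction with
    | mem Q hQ =>
      obtain ⟨n, rfl⟩ := hQ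
      have h1 : Polynomial.X * hermPoly n = Complex.I • ((√((n : ℝ) + 1) : ℂ) • hermPoly (n + 1)
          - (√(n : ℝ) : ℂ) • hermPoly (n - 1)) := by
        rw [hermPoly_succ, add_sub_cancel_right, smul_smul]
        simp
      rw [h1]
      exact S.smul_mem _ (S.sub_mem (S.smul_mem _ (hmem _)) (S.smul_mem _ (hmem _)))
    | zero => simp
    | add P Q _ _ hP hQ => rw [mul_add]; exact S.add_mem hP hQ
    | smul c Q _ hQ => rw [mul_smul_comm]; exact S.smul_mem _ hQ
  have h1 : (1 : ℂ[X]) ∈ S := by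
    have h2 : (1 : ℂ[X]) = ((gaussConst : ℂ))⁻¹ • hermPoly 0 := by
      rw [hermPoly_zero, smul_C, smul_eq_mul, inv_mul_cancel₀, C_1]
      exact_mod_cast gaussConst_ne_zero
    rw [h2]
    exact S.smul_mem _ (hmem 0)
  have hpow : ∀ n : ℕ, (Polynomial.X : ℂ[X]) ^ n ∈ S := by
    intro n
    induction n with
    | zero => simpa using h1
    | succ n ih => rw [pow_succ']; exact hX _ ih
  rw [eq_top_iff]
  intro Q _
  induction Q using Polynomial.induction_on' with
  | add P Q hP hQ => exact S.add_mem (hP trivial) (hQ trivial)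
  | monomial n c =>
    rw [← mul_one c, ← smul_eq_mul, ← smul_monomial, ← X_pow_eq_monomial]
    exact S.smul_mem _ (hpow n)

/-- The Hermite functions are complete. -/
theorem orthogonal_span_phaseLp (θ : ℝ[X]) :
    (Submodule.span ℂ (Set.range fun n => phaseLp θ (hermPoly n)))ᗮ = ⊥ := by
  rw [Submodule.eq_bot_iff]
  intro g hg
  rw [Submodule.mem_orthogonal] at hg
  have hQ : ∀ Q : ℂ[X], ⟪phaseLp θ Q, g⟫_ℂ = 0 := by
    intro Q
    apply hg
    have h1 : Q ∈ Submodule.span ℂ (Set.range hermPoly) := by rw [span_hermPoly]; trivial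
    have h2 := Submodule.mem_map_of_mem (f := phaseLp θ) h1
    rwa [Submodule.map_span, ← Set.range_comp] at h2
  set R := phaseExp θ with hR
  set G : ℝ → ℂ := fun x => conj (Complex.exp (R.eval (x : ℂ))) * g x with hG
  have hGm : AEStronglyMeasurable G volume := by
    refine AEStronglyMeasurable.mul (Continuous.aestronglyMeasurable ?_) (Lp.aestronglyMeasurable g)
    exact Complex.continuous_conj.comp
      (Complex.continuous_exp.comp (R.continuous.comp Complex.continuous_ofReal))
  have hGnorm : ∀ x, ‖G x‖ = Real.exp (-x ^ 2 / 4) * ‖g x‖ := by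
    intro x
    rw [hG]
    simp only
    rw [norm_mul, RCLike.norm_conj, Complex.norm_exp, hR, eval_phaseExp]
    congr 2
    rw [Complex.add_re, Complex.ofReal_re]
    simp
  have h8re : ∀ x : ℝ, ((C (-1 / 8 : ℂ) * Polynomial.X ^ 2).eval (x : ℂ)).re = -1 / 8 * x ^ 2 := by
    intro x
    have h1 : (C (-1 / 8 : ℂ) * Polynomial.X ^ 2).eval (x : ℂ) = ((-1 / 8 * x ^ 2 : ℝ) : ℂ) := by
      simp only [eval_mul, eval_C, eval_pow, eval_X]
      push_cast
      ring
    rw [h1, Complex.ofReal_re]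
  have h8 : GaussBound (C (-1 / 8) * Polynomial.X ^ 2) :=
    ⟨1 / 8, by norm_num, 0, fun x => by rw [h8re]; linarith⟩
  -- `G` has all exponential moments: half of the Gaussian absorbs `c|x|`, as `c|x| - x²/4 ≤ 2c² -
  -- x²/8`, and the other half pairs with `g` in `L²`.
  have hdom : ∀ c : ℝ, Integrable fun x : ℝ => Real.exp (c * |x|) * ‖G x‖ := by
    intro c
    have h1 : Integrable fun x => ‖gaussPoly 1 (C (-1 / 8) * Polynomial.X ^ 2) x‖ * ‖g x‖ :=
      (h8.memLp 1).norm.integrable_mul (Lp.memLp g).norm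
    refine (h1.const_mul (Real.exp (2 * c ^ 2))).mono'
      ((Continuous.aestronglyMeasurable (by fun_prop)).mul hGm.norm) (Eventually.of_forall fun x => ?_)
    rw [Real.norm_eq_abs, abs_of_nonneg (by positivity), hGnorm, gaussPoly, eval_one, one_mul,
      Complex.norm_exp, ← mul_assoc, ← mul_assoc, ← Real.exp_add, ← Real.exp_add]
    refine mul_le_mul_of_nonneg_right (Real.exp_le_exp.2 ?_) (norm_nonneg _)
    rw [h8re, ← sq_abs x]
    nlinarith [sq_nonneg (|x| - 4 * c)]
  have hGint : Integrable G := by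
    refine (hdom 0).mono' hGm (Eventually.of_forall fun x => ?_)
    simp
  have hmom : ∀ n : ℕ, ∫ x : ℝ, (x : ℂ) ^ n * G x = 0 := by
    intro n
    rw [← hQ (Polynomial.X ^ n), L2.inner_def]
    apply integral_congr_ae
    filter_upwards [coeFn_phaseLp θ (Polynomial.X ^ n)] with x hx
    rw [hx, RCLike.inner_apply, gaussPoly, map_mul, eval_pow, eval_X, map_pow, Complex.conj_ofReal]
    ring
  -- Expand the character in its power series; the exponential moments justify termwise integration
  -- and every moment of `G` is zero.
  have hzero := ae_eq_zero_of_fourier_eq_zero hGint (by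
    intro ξ
    set c : ℂ := ((-2 * Real.pi * ξ : ℝ) : ℂ) * Complex.I with hc
    have h1 := hasSum_integral_of_dominated_convergence (μ := volume)
      (F := fun (n : ℕ) (x : ℝ) => (c * x) ^ n / n.factorial * G x)
      (f := fun x : ℝ => Complex.exp (c * x) * G x)
      (fun n x => (‖c‖ * |x|) ^ n / n.factorial * ‖G x‖)
      (fun n => (Continuous.aestronglyMeasurable (by fun_prop)).mul hGm)
      (fun n => Eventually.of_forall fun x => by
        rw [norm_mul, norm_div, norm_pow, norm_mul, Complex.norm_real, Complex.norm_natCast,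
          Real.norm_eq_abs])
      (Eventually.of_forall fun x => (Real.summable_pow_div_factorial _).mul_right _)
      (by
        have h2 : (fun x : ℝ => ∑' n : ℕ, (‖c‖ * |x|) ^ n / n.factorial * ‖G x‖) =
            fun x => Real.exp (‖c‖ * |x|) * ‖G x‖ := by
          funext x
          rw [tsum_mul_right, Real.exp_eq_exp_ℝ, NormedSpace.exp_eq_tsum_div]
        rw [h2]
        exact hdom ‖c‖)
      (Eventually.of_forall fun x => by
        refine HasSum.mul_right (G x) ?_
        rw [Complex.exp_eq_exp_ℂ]
        exact NormedSpace.expSeries_div_hasSum_exp (c * x))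
    have h3 : ∀ n : ℕ, ∫ x : ℝ, (c * x) ^ n / n.factorial * G x = 0 := by
      intro n
      have h4 : (fun x : ℝ => (c * x) ^ n / n.factorial * G x) =
          fun x : ℝ => (c ^ n / n.factorial) * ((x : ℂ) ^ n * G x) := by
        funext x
        rw [mul_pow]
        ring
      rw [h4, integral_const_mul, hmom, mul_zero]
    simp only [h3] at h1
    rw [← h1.unique hasSum_zero]
    congr 1
    funext x
    rw [hc]
    congr 2
    push_cast
    ring)
  apply Lp.ext
  filter_upwards [hzero, Lp.coeFn_zero ℂ 2 (volume : Measure ℝ)] with x h1 h2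
  rw [h2, Pi.zero_apply]
  exact (mul_eq_zero.1 h1).resolve_left fun h0 =>
    Complex.exp_ne_zero _ ((_root_.map_eq_zero _).1 h0)

/-- The Hermite functions with phase `θ` as a Hilbert basis. -/
noncomputable def hermBasis (θ : ℝ[X]) : HilbertBasis ℕ ℂ (Lp ℂ 2 (volume : Measure ℝ)) :=
  HilbertBasis.mkOfOrthogonalEqBot (orthonormal_phaseLp θ) (orthogonal_span_phaseLp θ)

/-- The unitary from the Fock space to `L²` which diagonalizes `i(b† - b)`. -/
noncomputable def hermUnitary (θ : ℝ[X]) : Fock ≃ₗᵢ[ℂ] Lp ℂ 2 (volume : Measure ℝ) :=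
  (hermBasis θ).repr.symm

theorem hermUnitary_numVec (θ : ℝ[X]) (n : ℕ) :
    hermUnitary θ (numVec n) = phaseLp θ (hermPoly n) := by
  rw [hermUnitary, coe_numVec, HilbertBasis.repr_symm_single, hermBasis,
    HilbertBasis.coe_mkOfOrthogonalEqBot]

end Hermite

end CEHeis

namespace CEHeis

open Filter Topology Polynomial
open scoped SchwartzMap ContDiff

/-! ### Diagonalization of quadratic operators and the law of the vacuum -/

section Diagonalization

/-- The action of `quadOp l k` on polynomials times Gaussians. -/
noncomputable def quadPoly (l : ℝ) (k : ℂ) (Q : ℂ[X]) : ℂ[X] :=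
  (-(l : ℂ)) • (Polynomial.X * (Polynomial.X * Q)) + (2 * Complex.I * (k.re : ℂ)) • derivative Q
    - (Complex.I * (k.re : ℂ) + (k.im : ℂ)) • (Polynomial.X * Q)

/-- On the polynomial factor, `b` acts as `i d/dx` and `b†` as `i d/dx - ix`; the difference is
multiplication by `ix`, whose square is `-x²`. -/
theorem map_quadOp_numVec {F : Type*} [AddCommGroup F] [Module ℂ F] (V : smooth →ₗ[ℂ] F)
    (Γ : ℂ[X] →ₗ[ℂ] F) (hV : ∀ n, V (numVec n) = Γ (hermPoly n)) (l : ℝ) (k : ℂ) (n : ℕ) :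
    V (quadOp l k (numVec n)) = Γ (quadPoly l k (hermPoly n)) := by
  have hs : ∀ n : ℕ, (√(n : ℝ) : ℂ) • hermPoly (n - 1) = Complex.I • derivative (hermPoly n) := by
    intro n
    rw [derivative_hermPoly, smul_smul, ← mul_assoc]
    simp
  have hs' : ∀ n : ℕ, (√((n : ℝ) + 1) : ℂ) • hermPoly (n + 1) =
      Complex.I • derivative (hermPoly n) - Complex.I • (Polynomial.X * hermPoly n) := by
    intro n
    rw [hermPoly_succ, hs]
    module
  have hb : ∀ n, V (b (numVec n)) = Γ (Complex.I • derivative (hermPoly n)) := by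
    intro n
    rw [b_numVec, map_smul, hV, ← map_smul, hs]
  have hd : ∀ n, V (bdag (numVec n)) =
      Γ (Complex.I • derivative (hermPoly n) - Complex.I • (Polynomial.X * hermPoly n)) := by
    intro n
    rw [bdag_numVec, map_smul, hV, ← map_smul, hs']
  have hdiff : ∀ n, V (b (numVec n)) - V (bdag (numVec n)) =
      Γ (Complex.I • (Polynomial.X * hermPoly n)) := by
    intro n
    rw [hb, hd, ← map_sub, sub_sub_cancel]
  have hsq : V (b (b (numVec n)) - b (bdag (numVec n)) - bdag (b (numVec n))
      + bdag (bdag (numVec n))) = Γ (-(Polynomial.X * (Polynomial.X * hermPoly n))) := by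
    -- `V` is known on number vectors only, so the inner operator is expanded first and `hdiff` is
    -- applied at the indices `n - 1` and `n + 1`.
    have e1 : V (b (b (numVec n)) - b (bdag (numVec n)) - bdag (b (numVec n))
        + bdag (bdag (numVec n))) =
        (√(n : ℝ) : ℂ) • (V (b (numVec (n - 1))) - V (bdag (numVec (n - 1))))
        - (√((n : ℝ) + 1) : ℂ) • (V (b (numVec (n + 1))) - V (bdag (numVec (n + 1)))) := by
      rw [b_numVec n, bdag_numVec n]
      simp only [map_add, map_sub, map_smul]
      module
    rw [e1, hdiff, hdiff, ← map_smul, ← map_smul, ← map_sub]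
    congr 1
    rw [smul_comm (√(n : ℝ) : ℂ), smul_comm (√((n : ℝ) + 1) : ℂ),
      ← mul_smul_comm (√(n : ℝ) : ℂ), ← mul_smul_comm (√((n : ℝ) + 1) : ℂ),
      hs, hs', ← smul_sub, ← mul_sub, sub_sub_cancel, mul_smul_comm, smul_smul, Complex.I_mul_I,
      neg_one_smul]
  rw [quadOp_apply, map_add, map_add, map_smul, map_smul, map_smul, hsq, hb, hd, ← Γ.map_smul,
    ← Γ.map_smul, ← Γ.map_smul, ← Γ.map_add, ← Γ.map_add]
  congr 1
  rw [quadPoly]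
  have hk : conj k = (k.re : ℂ) - k.im * Complex.I := by
    apply Complex.ext <;> simp
  have hk' : k = (k.re : ℂ) + k.im * Complex.I := (Complex.re_add_im k).symm
  rw [hk]
  nth_rewrite 1 [hk']
  match_scalars
  · ring
  · ring
  · linear_combination (k.im : ℂ) * Complex.I_sq

theorem hermUnitary_quadOp (θ : ℝ[X]) (l : ℝ) (k : ℂ) (n : ℕ) :
    hermUnitary θ (quadOp l k (numVec n)) = phaseLp θ (quadPoly l k (hermPoly n)) :=
  map_quadOp_numVec ((hermUnitary θ).toLinearEquiv.toLinearMap ∘ₗ smooth.subtype) (phaseLp θ)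
    (hermUnitary_numVec θ) l k n

/-- With vanishing real part of the linear coefficient, the operator is a multiplication. -/
theorem isMulOperator_of_re_eq_zero {l : ℝ} {k : ℂ} (hk : k.re = 0) :
    IsMulOperator (LinearPMap.closure ⟨smooth, smooth.subtype ∘ₗ quadOp l k⟩) (hermUnitary 0)
      fun x => -l * x ^ 2 - k.im * x := by
  refine isMulOperator_quadOp (by fun_prop) fun n => ?_
  rw [hermUnitary_quadOp, hermUnitary_numVec]
  filter_upwards [coeFn_phaseLp 0 (quadPoly l k (hermPoly n)), coeFn_phaseLp 0 (hermPoly n)]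
    with x h1 h2
  rw [h1, h2, gaussPoly, gaussPoly, quadPoly, hk]
  simp only [eval_add, eval_sub, eval_smul, eval_mul, eval_X, smul_eq_mul]
  push_cast
  ring

/-- The phase which removes the multiplicative part of the operator. -/
noncomputable def cubicPhase (l : ℝ) (k : ℂ) : ℝ[X] :=
  C (l / (6 * k.re)) * Polynomial.X ^ 3 + C (k.im / (4 * k.re)) * Polynomial.X ^ 2

theorem phaseExp_cubicPhase (l : ℝ) (k : ℂ) : phaseExp (cubicPhase l k) =
    C (-1 / 4) * Polynomial.X ^ 2 + C Complex.I * (C ((l / (6 * k.re) : ℝ) : ℂ) * Polynomial.X ^ 3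
      + C ((k.im / (4 * k.re) : ℝ) : ℂ) * Polynomial.X ^ 2) := by
  simp [phaseExp, cubicPhase]

/-- The phase solves `2(Re k) θ' = l x² + (Im k) x`, so differentiating `e^{iθ}` produces exactly
the multiplicative terms of the operator. -/
theorem gaussPoly_quadPoly {l : ℝ} {k : ℂ} (hk : k.re ≠ 0) (Q : ℂ[X]) :
    gaussPoly (quadPoly l k Q) (phaseExp (cubicPhase l k)) =
      (2 * Complex.I * (k.re : ℂ)) • deriv (gaussPoly Q (phaseExp (cubicPhase l k))) := by
  rw [deriv_gaussPoly, ← gaussPoly_smul]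
  congr 1
  have hk' : (k.re : ℂ) ≠ 0 := Complex.ofReal_ne_zero.2 hk
  apply Polynomial.funext
  intro x
  rw [phaseExp_cubicPhase, quadPoly]
  simp only [eval_add, eval_sub, eval_smul, eval_mul, eval_X, smul_eq_mul, derivative_add,
    derivative_X_pow, eval_C, eval_pow, derivative_mul, derivative_C, eval_zero]
  push_cast
  field_simp
  linear_combination (-(24 * x * Q.eval x * (l * x + k.im))) * Complex.I_sq

open FourierTransform in
-- With the phase in place only `2i(Re k) d/dx` is left, and the Fourier transform replaces `d/dx`
-- by `2πiξ`.
theorem isMulOperator_of_re_ne_zero {l : ℝ} {k : ℂ} (hk : k.re ≠ 0) :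
    IsMulOperator (LinearPMap.closure ⟨smooth, smooth.subtype ∘ₗ quadOp l k⟩)
      ((hermUnitary (cubicPhase l k)).trans (Lp.fourierTransformₗᵢ ℝ ℂ))
      fun ξ => -4 * Real.pi * k.re * ξ := by
  refine isMulOperator_quadOp (by fun_prop) fun n => ?_
  rw [LinearIsometryEquiv.trans_apply, LinearIsometryEquiv.trans_apply, hermUnitary_quadOp,
    hermUnitary_numVec, phaseLp_eq, phaseLp_eq]
  set f := gaussSchwartz (gaussBound_phaseExp (cubicPhase l k)) (hermPoly n) with hf
  set g := gaussSchwartz (gaussBound_phaseExp (cubicPhase l k)) (quadPoly l k (hermPoly n)) with hg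
  have h1 : Lp.fourierTransformₗᵢ ℝ ℂ (f.toLp 2) = (𝓕 f).toLp 2 := SchwartzMap.toLp_fourier_eq f
  have h2 : Lp.fourierTransformₗᵢ ℝ ℂ (g.toLp 2) = (𝓕 g).toLp 2 := SchwartzMap.toLp_fourier_eq g
  rw [h1, h2]
  filter_upwards [(𝓕 f).coeFn_toLp 2, (𝓕 g).coeFn_toLp 2] with ξ h3 h4
  rw [h3, h4, SchwartzMap.fourier_coe, SchwartzMap.fourier_coe]
  have hgf : (g : ℝ → ℂ) = (2 * Complex.I * (k.re : ℂ)) • deriv f := gaussPoly_quadPoly hk _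
  have hderiv : 𝓕 (deriv f) ξ = (2 * Real.pi * Complex.I * ξ) • 𝓕 (f : ℝ → ℂ) ξ := by
    have hd : Integrable (deriv f) := by
      rw [hf, coe_gaussSchwartz, deriv_gaussPoly]
      exact (gaussBound_phaseExp _).integrable _
    rw [Real.fourier_deriv f.integrable f.differentiable hd]
  rw [hgf, Real.fourier_real_eq]
  simp only [Pi.smul_apply]
  simp_rw [smul_comm _ (2 * Complex.I * (k.re : ℂ))]
  rw [integral_smul, ← Real.fourier_real_eq, hderiv]
  simp only [smul_eq_mul]
  push_cast
  linear_combination (4 * Real.pi * k.re * ξ * 𝓕 (f : ℝ → ℂ) ξ) * Complex.I_sq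

/-- The Gaussian integral which gives the moment generating function. -/
theorem gaussian_mgf {κ : ℝ} (hκ : 0 < κ) (β δ : ℝ) :
    Integrable (fun x : ℝ => (√(2 * Real.pi))⁻¹ * Real.exp (-(κ / 2) * x ^ 2 + β * x + δ)) ∧
    ∫ x : ℝ, (√(2 * Real.pi))⁻¹ * Real.exp (-(κ / 2) * x ^ 2 + β * x + δ) =
      κ ^ (-(1 / 2) : ℝ) * Real.exp (β ^ 2 / (2 * κ) + δ) := by
  have h1 : (fun x : ℝ => (√(2 * Real.pi))⁻¹ * Real.exp (-(κ / 2) * x ^ 2 + β * x + δ)) =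
      fun x => ((√(2 * Real.pi))⁻¹ * Real.exp (β ^ 2 / (2 * κ) + δ)) *
        Real.exp (-(κ / 2) * (x - β / κ) ^ 2) := by
    funext x
    rw [mul_assoc, ← Real.exp_add]
    congr 2
    field_simp
    ring
  rw [h1]
  constructor
  · exact ((integrable_exp_neg_mul_sq (half_pos hκ)).comp_sub_right (β / κ)).const_mul _
  · rw [integral_const_mul, integral_sub_right_eq_self (fun x => Real.exp (-(κ / 2) * x ^ 2)),
      integral_gaussian, Real.rpow_neg hκ.le, ← Real.sqrt_eq_rpow,
      show Real.pi / (κ / 2) = (2 * Real.pi) / κ by field_simp, Real.sqrt_div (by positivity)]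
    have h2 : √(2 * Real.pi) ≠ 0 := by positivity
    have h3 : √κ ≠ 0 := by positivity
    field_simp

/-- The exponent of the moment generating function of the vacuum. -/
noncomputable def mgfExponent (l : ℝ) (k : ℂ) (s : ℝ) : ℝ :=
  k.re ^ 2 * s ^ 2 / 2 + l * k.re ^ 2 * s ^ 3 / 3

/-- On a horizontal line the imaginary cubic term loses its `x³`, since `Re (i (x + iy)³) = y³ -
3x²y`. The quadratic remainder changes the coefficient `1/4` of the Gaussian into `(1 + 2lt)/4`. -/
theorem re_eval_phaseExp_cubicPhase {k : ℂ} (hk : k.re ≠ 0) (l : ℝ) (x t : ℝ) :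
    ((phaseExp (cubicPhase l k)).eval ((x : ℂ) + ((k.re * t : ℝ) : ℂ) * Complex.I)).re =
      -((1 + 2 * l * t) / 4) * x ^ 2 - k.im * t / 2 * x
        + k.re ^ 2 * t ^ 2 / 4 + l * k.re ^ 2 * t ^ 3 / 6 := by
  have hI3 : Complex.I ^ 3 = -Complex.I := by rw [pow_succ, Complex.I_sq]; ring
  have hI4 : Complex.I ^ 4 = 1 := by rw [pow_succ, hI3, neg_mul, Complex.I_mul_I, neg_neg]
  have h1 : (phaseExp (cubicPhase l k)).eval ((x : ℂ) + ((k.re * t : ℝ) : ℂ) * Complex.I) =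
      ((-((1 + 2 * l * t) / 4) * x ^ 2 - k.im * t / 2 * x
        + k.re ^ 2 * t ^ 2 / 4 + l * k.re ^ 2 * t ^ 3 / 6 : ℝ) : ℂ)
      + ((-x * (k.re * t) / 2 + l / (6 * k.re) * (x ^ 3 - 3 * x * (k.re * t) ^ 2)
        + k.im / (4 * k.re) * (x ^ 2 - (k.re * t) ^ 2) : ℝ) : ℂ) * Complex.I := by
    have hk' : (k.re : ℂ) ≠ 0 := Complex.ofReal_ne_zero.2 hk
    rw [phaseExp_cubicPhase]
    simp only [eval_add, eval_mul, eval_C, eval_pow, eval_X]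
    push_cast
    field_simp
    ring_nf
    rw [hI3, hI4, Complex.I_sq]
    ring
  rw [h1, Complex.add_re, Complex.ofReal_re, Complex.re_ofReal_mul, Complex.I_re, mul_zero,
    add_zero]

/-- The exponent shifted by `i k.re s`. -/
noncomputable def shiftExp (l : ℝ) (k : ℂ) (s : ℝ) : ℂ[X] :=
  (phaseExp (cubicPhase l k)).comp (Polynomial.X + C (((k.re * s : ℝ) : ℂ) * Complex.I))

theorem eval_shiftExp (l : ℝ) (k : ℂ) (s : ℝ) (w : ℂ) : (shiftExp l k s).eval w =
    (phaseExp (cubicPhase l k)).eval (w + ((k.re * s : ℝ) : ℂ) * Complex.I) := by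
  simp [shiftExp, eval_comp]

/-- Uniform Gaussian decay in the strip over which the contour is moved. -/
theorem exists_gaussian_bound {l : ℝ} {k : ℂ} (hk : k.re ≠ 0) {s : ℝ} (hs : 0 < 1 + 2 * l * s) :
    ∃ c : ℝ, 0 < c ∧ ∃ A : ℝ, ∀ u ∈ Set.Icc (0 : ℝ) 1, ∀ x : ℝ,
      ((phaseExp (cubicPhase l k)).eval ((x : ℂ) + ((k.re * (u * s) : ℝ) : ℂ) * Complex.I)).re ≤
        A - c * x ^ 2 := by
  -- `1 + 2lus` is affine in `u`, so on `[0, 1]` it is bounded below by its smaller endpoint value.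
  -- Half of the resulting decay `κ/4` absorbs the linear term, leaving `κ/8`.
  set κ := min 1 (1 + 2 * l * s) with hκ
  have hκ0 : 0 < κ := lt_min one_pos hs
  set B := |k.im| * |s| / 2 with hB
  refine ⟨κ / 8, by positivity, 2 * B ^ 2 / κ + (k.re ^ 2 * s ^ 2 / 4 + |l| * k.re ^ 2 * |s| ^ 3 / 6),
    fun u hu x => ?_⟩
  rw [re_eval_phaseExp_cubicPhase hk]
  have h1 : κ ≤ 1 + 2 * l * (u * s) := by
    have e1 : κ ≤ 1 := min_le_left _ _
    have e2 : κ ≤ 1 + 2 * l * s := min_le_right _ _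
    have e3 : 1 + 2 * l * (u * s) = (1 - u) * 1 + u * (1 + 2 * l * s) := by ring
    rw [e3]
    nlinarith [hu.1, hu.2]
  have h2 : -(k.im * (u * s) / 2 * x) ≤ B * |x| := by
    refine (neg_le_abs _).trans ?_
    rw [abs_mul, abs_div, abs_mul, abs_mul, abs_of_nonneg hu.1, abs_two, hB]
    have : |k.im| * (u * |s|) ≤ |k.im| * |s| := by
      gcongr
      exact mul_le_of_le_one_left (abs_nonneg s) hu.2
    gcongr
  have h3 : B * |x| ≤ 2 * B ^ 2 / κ + κ / 8 * x ^ 2 := by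
    rw [← sq_abs x, div_add' _ _ _ hκ0.ne', le_div_iff₀ hκ0]
    nlinarith [sq_nonneg (4 * B - κ * |x|)]
  have h4 : k.re ^ 2 * (u * s) ^ 2 / 4 ≤ k.re ^ 2 * s ^ 2 / 4 := by
    have : (u * s) ^ 2 ≤ s ^ 2 := by
      rw [mul_pow]
      exact mul_le_of_le_one_left (sq_nonneg s) (pow_le_one₀ hu.1 hu.2)
    gcongr
  have h5 : l * k.re ^ 2 * (u * s) ^ 3 / 6 ≤ |l| * k.re ^ 2 * |s| ^ 3 / 6 := by
    have e1 : l * (u * s) ^ 3 ≤ |l| * |s| ^ 3 := by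
      refine (le_abs_self _).trans ?_
      have hu0 := hu.1
      rw [abs_mul, abs_pow, abs_mul, abs_of_nonneg hu0]
      gcongr
      exact mul_le_of_le_one_left (abs_nonneg s) hu.2
    have := mul_le_mul_of_nonneg_left e1 (sq_nonneg k.re)
    linarith
  have h6 : -((1 + 2 * l * (u * s)) / 4) * x ^ 2 ≤ -(κ / 4) * x ^ 2 := by
    have := mul_le_mul_of_nonneg_right h1 (sq_nonneg x)
    linarith
  linarith

theorem gaussBound_shiftExp {l : ℝ} {k : ℂ} (hk : k.re ≠ 0) {s : ℝ} (hs : 0 < 1 + 2 * l * s) :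
    GaussBound (shiftExp l k s) := by
  obtain ⟨c, hc, A, hA⟩ := exists_gaussian_bound hk hs
  refine ⟨c, hc, A, fun x => ?_⟩
  have := hA 1 ⟨zero_le_one, le_rfl⟩ x
  rwa [one_mul, ← eval_shiftExp] at this

open FourierTransform in
/-- The Fourier transform of the shifted ground state. -/
theorem fourier_shiftExp {l : ℝ} {k : ℂ} (hk : k.re ≠ 0) {s : ℝ} (hs : 0 < 1 + 2 * l * s)
    (Q : ℂ) (ξ : ℝ) :
    𝓕 (gaussPoly (C Q) (shiftExp l k s)) ξ = Real.exp (-2 * Real.pi * (k.re * s) * ξ) *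
      𝓕 (gaussPoly (C Q) (phaseExp (cubicPhase l k))) ξ := by
  obtain ⟨c, hc, A, hA⟩ := exists_gaussian_bound hk hs
  set f : ℂ → ℂ := fun w => Complex.exp ((phaseExp (cubicPhase l k)).eval w
    + (-2 * Real.pi * ξ * Complex.I) * w) with hf
  have hfd : Differentiable ℂ f :=
    (((phaseExp (cubicPhase l k)).differentiable).add (differentiable_id.const_mul _)).cexp
  have hshift := integral_shift_of_gaussian_decay (f := f) (σ := k.re * s)
    (C := A + 2 * Real.pi * |k.re * s| * |ξ|) hfd hc (by
      intro x y hy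
      obtain ⟨u, hu, rfl⟩ : ∃ u ∈ Set.Icc (0 : ℝ) 1, k.re * (u * s) = y := by
        rw [← segment_eq_uIcc] at hy
        obtain ⟨p, u, hp, hu, hpu, rfl⟩ := hy
        refine ⟨u, ⟨hu, by linarith⟩, ?_⟩
        simp only [smul_eq_mul]
        ring
      rw [hf, Complex.norm_exp, Complex.add_re]
      apply Real.exp_le_exp.2
      have h1 := hA u hu x
      have h2 : ((-2 * Real.pi * ξ * Complex.I) * ((x : ℂ) + ((k.re * (u * s) : ℝ) : ℂ) * Complex.I)).re
          = 2 * Real.pi * (u * (k.re * s)) * ξ := by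
        simp
        ring
      have h3 : u * (k.re * s) * ξ ≤ |k.re * s| * |ξ| := by
        refine (le_abs_self _).trans ?_
        rw [abs_mul, abs_mul, abs_of_nonneg hu.1]
        gcongr
        exact mul_le_of_le_one_left (abs_nonneg _) hu.2
      have h4 := mul_le_mul_of_nonneg_left h3 Real.two_pi_pos.le
      rw [h2]
      linarith)
  rw [Real.fourier_real_eq_integral_exp_smul, Real.fourier_real_eq_integral_exp_smul]
  -- With `σ = s Re k`, the character at the shifted point gains `e^{2πξσ}`; the prefactor
  -- compensates for it.
  have h1 : (fun v : ℝ => Complex.exp (((-2 * Real.pi * v * ξ : ℝ) : ℂ) * Complex.I) •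
      gaussPoly (C Q) (shiftExp l k s) v) = fun v : ℝ => (Q * Real.exp (-2 * Real.pi * (k.re * s) * ξ)) *
        f (v + ((k.re * s : ℝ) : ℂ) * Complex.I) := by
    funext v
    rw [gaussPoly, eval_shiftExp, eval_C, hf, smul_eq_mul, Complex.ofReal_exp, mul_assoc Q,
      ← Complex.exp_add, mul_left_comm, ← Complex.exp_add]
    congr 2
    push_cast
    linear_combination (2 * Real.pi * ξ * k.re * s) * Complex.I_sq
  have h2 : (fun v : ℝ => Complex.exp (((-2 * Real.pi * v * ξ : ℝ) : ℂ) * Complex.I) •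
      gaussPoly (C Q) (phaseExp (cubicPhase l k)) v) = fun v : ℝ => Q * f v := by
    funext v
    rw [gaussPoly, eval_C, hf, smul_eq_mul, mul_left_comm, ← Complex.exp_add]
    congr 2
    push_cast
    ring
  rw [h1, h2, integral_const_mul, integral_const_mul, hshift]
  ring

open FourierTransform in
/-- The moment generating function of the vacuum law. -/
theorem vacuum_mgf {l : ℝ} {k : ℂ} {E : ProjectionMeasure Fock}
    (hE : E.IsSpectralMeasureOf (LinearPMap.closure ⟨smooth, smooth.subtype ∘ₗ quadOp l k⟩))
    {s : ℝ} (hs : 0 < 1 + 2 * l * s) :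
    Integrable (fun x : ℝ => Real.exp (s * x)) (E.law vacuum) ∧
    ∫ x, Real.exp (s * x) ∂(E.law vacuum) = (1 + 2 * l * s) ^ (-(1 / 2) : ℝ) *
      Real.exp ((-k.im * s) ^ 2 / (2 * (1 + 2 * l * s)) + mgfExponent l k s) := by
  obtain ⟨hi, hv⟩ := gaussian_mgf hs (-k.im * s) (mgfExponent l k s)
  rw [← hv]
  have hg : Measurable fun x : ℝ => Real.exp (s * x) := by fun_prop
  by_cases hk : k.re = 0
  · rw [hE.law_eq (isMulOperator_of_re_eq_zero hk) (by fun_prop),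
      integrable_map_sqMeasure_iff _ (by fun_prop) hg, integral_map_sqMeasure _ (by fun_prop) hg]
    have hae : (fun x : ℝ => (√(2 * Real.pi))⁻¹ *
        Real.exp (-((1 + 2 * l * s) / 2) * x ^ 2 + -k.im * s * x + mgfExponent l k s)) =ᵐ[volume]
        fun x => ‖hermUnitary 0 vacuum x‖ ^ 2 * Real.exp (s * (-l * x ^ 2 - k.im * x)) := by
      rw [vacuum_eq, hermUnitary_numVec, hermPoly_zero]
      filter_upwards [coeFn_phaseLp 0 (C (gaussConst : ℂ))] with x hx
      rw [hx, gaussPoly, eval_C, norm_mul, Complex.norm_real, mul_pow, Real.norm_eq_abs, sq_abs,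
        sq gaussConst, gaussConst_sq, Complex.norm_exp, eval_phaseExp, ← Real.exp_nat_mul,
        mul_assoc (√(2 * Real.pi))⁻¹,
        ← Real.exp_add, mgfExponent, hk, Complex.add_re, Complex.ofReal_re, eval_zero,
        Complex.ofReal_zero, mul_zero, Complex.zero_re]
      congr 2
      push_cast
      ring
    exact ⟨hi.congr hae, (integral_congr_ae hae).symm⟩
  · rw [hE.law_eq (isMulOperator_of_re_ne_zero hk) (by fun_prop),
      integrable_map_sqMeasure_iff _ (by fun_prop) hg, integral_map_sqMeasure _ (by fun_prop) hg]
    set f := gaussSchwartz (gaussBound_phaseExp (cubicPhase l k)) (C (gaussConst : ℂ)) with hf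
    set g := gaussSchwartz (gaussBound_shiftExp hk hs) (C (gaussConst : ℂ)) with hg
    -- The weight `e^{-4πs(Re k)ξ}` is the square of the factor in `fourier_shiftExp`, so the
    -- weighted density of the vacuum is that of the shifted ground state; Plancherel then returns
    -- to a Gaussian in `x`.
    have hae : (fun ξ : ℝ => ‖𝓕 g ξ‖ ^ 2) =ᵐ[volume] fun ξ =>
        ‖((hermUnitary (cubicPhase l k)).trans (Lp.fourierTransformₗᵢ ℝ ℂ)) vacuum ξ‖ ^ 2 *
          Real.exp (s * (-4 * Real.pi * k.re * ξ)) := by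
      have h1 : Lp.fourierTransformₗᵢ ℝ ℂ (f.toLp 2) = (𝓕 f).toLp 2 := SchwartzMap.toLp_fourier_eq f
      rw [vacuum_eq, LinearIsometryEquiv.trans_apply, hermUnitary_numVec, hermPoly_zero, phaseLp_eq,
        h1]
      filter_upwards [(𝓕 f).coeFn_toLp 2] with ξ h2
      rw [h2, SchwartzMap.fourier_coe, SchwartzMap.fourier_coe, hg, coe_gaussSchwartz,
        fourier_shiftExp hk hs, hf, coe_gaussSchwartz, norm_mul, mul_pow, Complex.norm_real,
        Real.norm_eq_abs, sq_abs, ← Real.exp_nat_mul, mul_comm]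
      congr 2
      push_cast
      ring
    have hval : ∀ x, ‖g x‖ ^ 2 = (√(2 * Real.pi))⁻¹ *
        Real.exp (-((1 + 2 * l * s) / 2) * x ^ 2 + -k.im * s * x + mgfExponent l k s) := by
      intro x
      rw [hg, gaussSchwartz_apply, gaussPoly, eval_C, norm_mul, Complex.norm_real, mul_pow,
        Real.norm_eq_abs, sq_abs, sq gaussConst, gaussConst_sq, Complex.norm_exp, eval_shiftExp,
        re_eval_phaseExp_cubicPhase hk, ← Real.exp_nat_mul, mgfExponent]
      congr 2
      push_cast
      ring
    refine ⟨Integrable.congr ?_ hae, ?_⟩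
    · exact (memLp_two_iff_integrable_sq_norm (𝓕 g).continuous.aestronglyMeasurable).1
        ((𝓕 g).memLp 2 volume)
    · rw [← integral_congr_ae hae, SchwartzMap.integral_norm_sq_fourier]
      simp_rw [hval]

end Diagonalization

end CEHeis

/-! ### Reduction of the given operators to the quadratic form, and the conclusion. -/

namespace CEHeis

theorem conj_M (z : ℂ) (r : ℝ) : conj (M z r) = N z r := by
  unfold M N
  split_ifs
  · simp only [map_sub, map_mul, map_div₀, Complex.conj_ofReal, Complex.conj_I, map_ofNat]
    ring
  · simp only [map_neg, map_add, map_mul, map_div₀, Complex.conj_ofReal, Complex.conj_I]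
    ring

theorem a_add_adag_add_h (z : ℂ) (ρ r : ℝ) (hr : r ≠ 0) :
    a z ρ r + adag z ρ r + h z r = quadOp (L z ρ r) (M z r) := by
  have hr' : (r : ℂ) ≠ 0 := Complex.ofReal_ne_zero.2 hr
  rw [quadOp, conj_M]
  unfold a adag h L M N
  split_ifs with hz
  · match_scalars
    · ring
    · field_simp
      ring
    · field_simp
      ring
  · have hz' : (z.re : ℂ) ≠ 0 := Complex.ofReal_ne_zero.2 hz
    have hconj : conj z = z.re - Complex.I * z.im := by
      apply Complex.ext <;> simp
    have hz2 : z = z.re + Complex.I * z.im := by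
      apply Complex.ext <;> simp
    have h₁ : -(Complex.I * conj z / (2 * r)) + Complex.I * z / (2 * r) = -(z.im / r : ℂ) := by
      rw [hconj]
      field_simp
      linear_combination Complex.I * hz2 + 2 * (z.im : ℂ) * Complex.I_sq
    match_scalars
    · field_simp
      ring
    · linear_combination h₁
    · linear_combination h₁

theorem X_eq (z : ℂ) (ρ r : ℝ) (hr : r ≠ 0) :
    X z ρ r = LinearPMap.closure ⟨smooth, smooth.subtype ∘ₗ quadOp (L z ρ r) (M z r)⟩ := by
  rw [X, a_add_adag_add_h z ρ r hr]

theorem exists_isSpectralMeasureOf (l : ℝ) (k : ℂ) : ∃ E : ProjectionMeasure Fock,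
    E.IsSpectralMeasureOf (LinearPMap.closure ⟨smooth, smooth.subtype ∘ₗ quadOp l k⟩) := by
  by_cases hk : k.re = 0
  · exact ⟨_, (isMulOperator_of_re_eq_zero hk).isSpectralMeasureOf (by fun_prop)⟩
  · exact ⟨_, (isMulOperator_of_re_ne_zero hk).isSpectralMeasureOf (by fun_prop)⟩

end CEHeis

theorem mainTheorem5 (z : ℂ) (ρ r : ℝ) (hr : r ≠ 0) :
    (∃ E : CEHeis.ProjectionMeasure CEHeis.Fock, E.IsSpectralMeasureOf (CEHeis.X z ρ r)) ∧
    ∀ E : CEHeis.ProjectionMeasure CEHeis.Fock, E.IsSpectralMeasureOf (CEHeis.X z ρ r) →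
      ∀ s : ℝ, 0 < 2 * CEHeis.L z ρ r * s + 1 →
        Integrable (fun x : ℝ => Real.exp (s * x)) (E.law CEHeis.vacuum) ∧
        ((∫ x, Real.exp (s * x) ∂(E.law CEHeis.vacuum) : ℝ) : ℂ) =
          (((2 * CEHeis.L z ρ r * s + 1) ^ (-(1 / 2) : ℝ) : ℝ) : ℂ) *
            Complex.exp
              (((CEHeis.M z r + CEHeis.N z r) ^ 2 *
                    ((CEHeis.L z ρ r : ℂ) ^ 2 * (s : ℂ) ^ 4 + 2 * (CEHeis.L z ρ r : ℂ) * (s : ℂ) ^ 3)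
                  + 3 * CEHeis.M z r * CEHeis.N z r * (s : ℂ) ^ 2) /
                (6 * (2 * (CEHeis.L z ρ r : ℂ) * (s : ℂ) + 1))) := by
  rw [CEHeis.X_eq z ρ r hr]
  refine ⟨CEHeis.exists_isSpectralMeasureOf _ _, fun E hE s hs => ?_⟩
  rw [add_comm] at hs
  obtain ⟨h1, h2⟩ := CEHeis.vacuum_mgf hE hs
  refine ⟨h1, ?_⟩
  rw [h2, ← CEHeis.conj_M]
  set k := CEHeis.M z r
  set l := CEHeis.L z ρ r
  -- Since `N` is the conjugate of `M`, `M + N = 2 Re M` and `MN = |M|²`; it remains to put both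
  -- exponents over the denominator `6(1 + 2Ls)`.
  rw [Complex.add_conj, mul_assoc 3 k, Complex.mul_conj, Complex.normSq_apply, Complex.ofReal_mul,
    add_comm (2 * l * s), add_comm (2 * (l : ℂ) * s), Complex.ofReal_exp]
  congr 2
  have h3 : (1 + 2 * l * s : ℂ) ≠ 0 := by exact_mod_cast hs.ne'
  rw [CEHeis.mgfExponent]
  push_cast
  generalize hD : (1 + 2 * l * s : ℂ) = D at h3
  field_simp
  rw [← hD]
  ring
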